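/- Let $X\in\mathbb R^{n\times p}$ with $p\ge 2$, let $\beta^*\in\mathbb R^p$, $S=\mathrm{supp}(\beta^*)$, $s=|S|$, $T=\{1,\dots,p\}\setminus S$, let $X_S,X_T$ be the submatrices of $X$ formed by the columns in $S$, $T$, and let $X_j$ denote the $j$-th column of $X$. Observe $y=X\beta^*+\epsilon$ with $\epsilon\sim\mathcal N(0,\sigma^2I_n)$, $\sigma>0$. Write $\|u\|_n=\|u\|_2/\sqrt n$ and $M=\max_{j\in T}\|X_j\|_n$, and assume $M>0$ (in particular $T\neq\emptyset$). Assume: (A1) (restricted strong convexity) $\frac1nX_S^TX_S\succeq\gamma I$ for some $\gamma\in(0,1]$; (A2) (irrepresentable condition) $\big\|\frac1nX_T^TX_S\,(\frac1nX_S^TX_S)^{-1}\big\|_\infty\le 1-\eta$ for some $\eta\in(0,1)$, where $\|\cdot\|_\infty$ is the largest absolute row sum. A Bregman ISS path is a pair $(\beta_t,\rho_t)_{t\ge0}$ in $\mathbb R^p$ with $\beta_0=\rho_0=0$, $\beta$ right continuous, $\rho$ continuous and right differentiable, such that for all $t\ge0$ $$\dot\rho_t=\tfrac1nX^T(y-X\beta_t),\qquad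 \rho_t\in\partial\|\beta_t\|_1,$$ where $\dot\rho_t$ is the right derivative. Let $$\bar\tau=\frac{\eta}{2\sigma}\sqrt{\frac n{\log p}}\;M^{-1},$$ and let the oracle estimator $\tilde\beta^*$ be given by $\tilde\beta^*_S=(\frac1nX_S^TX_S)^{-1}\frac1nX_S^Ty$ and $\tilde\beta^*_T=0$. Then there is an event of probability at least $1-\dfrac{2}{p\sqrt{\pi\log p}}$ on which a Bregman ISS path exists and every Bregman ISS path satisfies the following. A. (No false positives) $\mathrm{supp}(\beta_t)\subseteq S$ for all $0\le t\le\bar\tau$. B. (Sign consistency) If moreover $$|\beta^*_i|\;\ge\;\left(\frac{4\sigma}{\sqrt\gamma}\vee\frac{8\sigma(2+\log s)M}{\gamma\eta}\right)\sqrt{\frac{\log p}{n}}\qquad\text{for all } i\in S,$$ then $\mathrm{sign}(\beta_{\bar\tau})=\mathrm{sign}(\beta^*)$ and $\beta_{\bar\tau}=\tilde\beta^*$. (If $S=\emptyset$, the condition is void.) Furthermore, the oracle estimator is unbiased: $\mathbb E[\tilde\beta^*]=\beta^*$. -/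

import Mathlib

open MeasureTheory ProbabilityTheory

namespace BregmanISS

noncomputable section

/-- The `ℓ¹`-norm on `ℝ^p`. -/
def l1norm {p : ℕ} (b : Fin p → ℝ) : ℝ := ∑ i, |b i|

/-- The subdifferential `∂‖b‖₁` of the `ℓ¹`-norm at `b`: all `g` such that
`‖b‖₁ + ⟨g, z - b⟩ ≤ ‖z‖₁` for every `z`. -/
def subdiffL1 {p : ℕ} (b : Fin p → ℝ) : Set (Fin p → ℝ) :=
  {g | ∀ z : Fin p → ℝ, l1norm b + ∑ i, g i * (z i - b i) ≤ l1norm z}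

/-- `(β, ρ)` is a Bregman ISS path for the data `(X, y)`: started at `ρ₀ = 0`, `β₀ = 0`,
for all `t ≥ 0` the path `β` is right continuous, `ρ` is continuous with right derivative
`(1/n) Xᵀ (y - X β_t)` (which is then right continuous), and `ρ_t ∈ ∂‖β_t‖₁`.
Only times `t ≥ 0` matter. -/
structure IsPath {n p : ℕ} (X : Matrix (Fin n) (Fin p) ℝ) (y : Fin n → ℝ)
    (β ρ : ℝ → Fin p → ℝ) : Prop where
  beta_zero : β 0 = 0
  rho_zero : ρ 0 = 0
  rho_continuous : ContinuousOn ρ (Set.Ici 0)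
  beta_rightContinuous : ∀ t : ℝ, 0 ≤ t → ContinuousWithinAt β (Set.Ici t) t
  rho_rightDeriv : ∀ t : ℝ, 0 ≤ t →
    HasDerivWithinAt ρ ((1 / (n : ℝ)) • (X.transpose.mulVec (y - X.mulVec (β t)))) (Set.Ici t) t
  rho_mem : ∀ t : ℝ, 0 ≤ t → ρ t ∈ subdiffL1 (β t)

/-- The support `S` of a vector, as an index type. -/
abbrev Supp {p : ℕ} (b : Fin p → ℝ) : Type := {i : Fin p // b i ≠ 0}

/-- The complement `T` of the support, as an index type. -/
abbrev Cosupp {p : ℕ} (b : Fin p → ℝ) : Type := {i : Fin p // b i = 0}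

/-- The submatrix `X_S` of the columns in the support of `b`. -/
def XS {n p : ℕ} (X : Matrix (Fin n) (Fin p) ℝ) (b : Fin p → ℝ) :
    Matrix (Fin n) (Supp b) ℝ := X.submatrix id Subtype.val

/-- The submatrix `X_T` of the columns outside the support of `b`. -/
def XT {n p : ℕ} (X : Matrix (Fin n) (Fin p) ℝ) (b : Fin p → ℝ) :
    Matrix (Fin n) (Cosupp b) ℝ := X.submatrix id Subtype.val

/-- The restricted Gram matrix `X_S^* X_S = (1/n) X_Sᵀ X_S`. -/
def gramS {n p : ℕ} (X : Matrix (Fin n) (Fin p) ℝ) (b : Fin p → ℝ) :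
    Matrix (Supp b) (Supp b) ℝ := (1 / (n : ℝ)) • ((XS X b).transpose * XS X b)

/-- Restricted strong convexity: `X_S^* X_S ≥ γ I` in the Loewner order. -/
def RestrictedStrongConvexity {n p : ℕ} (X : Matrix (Fin n) (Fin p) ℝ) (b : Fin p → ℝ)
    (γ : ℝ) : Prop :=
  (gramS X b - γ • (1 : Matrix (Supp b) (Supp b) ℝ)).PosSemidef

/-- Irrepresentable condition:
`‖(1/n) X_Tᵀ X_S ((1/n) X_Sᵀ X_S)⁻¹‖_∞ ≤ 1 - η`, where `‖·‖_∞` is the largest absolute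
row sum. -/
def Irrepresentable {n p : ℕ} (X : Matrix (Fin n) (Fin p) ℝ) (b : Fin p → ℝ) (η : ℝ) : Prop :=
  ∀ j : Cosupp b,
    ∑ i : Supp b,
      |(((1 / (n : ℝ)) • ((XT X b).transpose * XS X b)) * (gramS X b)⁻¹) j i| ≤ 1 - η

/-- The normalized norm `‖X_j‖_n = ‖X_j‖₂ / √n` of the `j`-th column. -/
def colNorm {n p : ℕ} (X : Matrix (Fin n) (Fin p) ℝ) (j : Fin p) : ℝ :=
  √((1 / (n : ℝ)) * ∑ i, X i j ^ 2)

/-- `max_{j ∈ T} ‖X_j‖_n`. -/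
def maxColNormT {n p : ℕ} (X : Matrix (Fin n) (Fin p) ℝ) (b : Fin p → ℝ) : ℝ :=
  ⨆ j : Cosupp b, colNorm X j

/-- The stopping time `τ̄ = η / (2σ) · √(n / log p) · (max_{j ∈ T} ‖X_j‖_n)⁻¹`. -/
def tauBar {n p : ℕ} (X : Matrix (Fin n) (Fin p) ℝ) (b : Fin p → ℝ) (σ η : ℝ) : ℝ :=
  η / (2 * σ) * √((n : ℝ) / Real.log p) * (maxColNormT X b)⁻¹

/-- The oracle estimator: least squares on the columns in the support `S` of `b`, that is
`((1/n) X_Sᵀ X_S)⁻¹ (1/n) X_Sᵀ y` on `S`, and zero outside `S`. -/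
def oracle {n p : ℕ} (X : Matrix (Fin n) (Fin p) ℝ) (b : Fin p → ℝ) (y : Fin n → ℝ) :
    Fin p → ℝ := fun i =>
  if h : b i ≠ 0 then
    ((gramS X b)⁻¹.mulVec ((1 / (n : ℝ)) • ((XS X b).transpose.mulVec y))) ⟨i, h⟩
  else 0

/-- The signal strength threshold
`(4σ / √γ ∨ 8σ (2 + log s) max_{j ∈ T} ‖X_j‖_n / (γ η)) · √(log p / n)`, `s = |S|`. -/
def signalThreshold {n p : ℕ} (X : Matrix (Fin n) (Fin p) ℝ) (b : Fin p → ℝ)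
    (σ γ η : ℝ) : ℝ :=
  max (4 * σ / √γ)
    (8 * σ * (2 + Real.log (Fintype.card (Supp b))) * maxColNormT X b / (γ * η)) *
      √(Real.log p / (n : ℝ))

end

end BregmanISS

/-! Randomness enters through a single event. Let G be the restricted Gram matrix and Q the
projection `residProj`. On S the oracle differs from β* by G⁻¹(1/n)X_Sᵀε; off S the noise acts only
through w = (1/n)X_TᵀQε. These are p centred Gaussian forms, one per coordinate (`noiseCoeff`), with
variances at most σ²/(nγ) and σ²M²/n. A union bound keeps each below 2√(log p) times the
corresponding deviation (`exists_event_abs_noise_sum_lt`). The rest is deterministic.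

No false positives (`IsPath.abs_rho_lt_one`): while β lives on S, the gradient g obeys g_T = A g_S +
w with A the irrepresentable matrix, and this integrates to ρ_T = A ρ_S + t w. Since |ρ_i| ≤ 1, the
first term is at most 1 - η; the second stays below η up to τ̄. Hence |ρ_j| cannot reach 1 for j in
T.

Sign consistency (`IsPath.beta_eq_of_le`): the Bregman distance D = Σ (|u_i| - ρ_i u_i) to the
oracle u satisfies D' ≤ -γ‖u - β‖². A coordinate contributes to D only if β_i does not share the
sign of u_i, so ‖u - β‖² is bounded below in terms of D. By `exists_eq_zero_of_bihari`, D vanishes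
by time 2(2 + log s)/(γm), where m bounds |u_i| from below on S. The signal condition permits m to
be half the threshold and brings this time below τ̄. Finally D = 0 forces β = u.

Existence (`exists_isPathFrom`): given ρ, take β to minimise the residual over the cone of all β
with ρ ∈ ∂‖β‖₁. Then ρ moves linearly until some moving coordinate hits ±1, and the minimisation is
repeated. The residual drops strictly at each restart and there are finitely many cones, so the
procedure stops. -/

namespace BregmanISS

open Matrix

/-! ### Gaussian linear forms, tail bounds and the noise event -/

/-- A linear combination of independent centred Gaussians is Gaussian. -/
lemma hasLaw_pi_gaussianReal_sum {ι : Type*} [Fintype ι] (v : NNReal) (a : ι → ℝ) :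
    HasLaw (fun x : ι → ℝ => ∑ k, a k * x k)
      (gaussianReal 0 (v * Real.toNNReal (∑ k, a k ^ 2)))
      (Measure.pi fun _ : ι => gaussianReal 0 v) := by
  have hm : Measurable (fun x : ι → ℝ => ∑ k, a k * x k) := by fun_prop
  refine ⟨hm.aemeasurable, ?_⟩
  have : IsProbabilityMeasure
      ((Measure.pi fun _ : ι => gaussianReal 0 v).map fun x : ι → ℝ => ∑ k, a k * x k) :=
    Measure.isProbabilityMeasure_map hm.aemeasurable
  refine Measure.ext_of_charFun (funext fun t => ?_)
  rw [charFun_gaussianReal, charFun_apply_real, integral_map hm.aemeasurable (by fun_prop)]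
  have h1 : ∀ x : ι → ℝ, Complex.exp (t * ((∑ k, a k * x k : ℝ) : ℂ) * Complex.I)
      = ∏ k, Complex.exp (((t * a k : ℝ) : ℂ) * (x k : ℂ) * Complex.I) := by
    intro x
    rw [← Complex.exp_sum]
    push_cast
    rw [Finset.mul_sum, Finset.sum_mul]
    congr 1
    exact Finset.sum_congr rfl fun k _ => by ring
  simp_rw [h1]
  rw [integral_fintype_prod_eq_prod
    (fun k (x : ℝ) => Complex.exp (((t * a k : ℝ) : ℂ) * (x : ℂ) * Complex.I))]
  simp_rw [← charFun_apply_real, charFun_gaussianReal]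
  rw [← Complex.exp_sum]
  congr 1
  have h2 : ((Real.toNNReal (∑ k, a k ^ 2) : NNReal) : ℝ) = ∑ k, a k ^ 2 :=
    Real.coe_toNNReal _ (Finset.sum_nonneg fun k _ => sq_nonneg _)
  rw [NNReal.coe_mul, h2]
  push_cast
  rw [Finset.mul_sum, Finset.sum_mul, Finset.sum_div, mul_zero, zero_mul, zero_sub,
    ← Finset.sum_neg_distrib]
  exact Finset.sum_congr rfl fun k _ => by ring

/-- Mills' bound for the upper tail of the standard Gaussian. -/
lemma gaussianReal_real_Ioi_le {a : ℝ} (ha : 0 < a) :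
    (gaussianReal 0 1).real (Set.Ioi a) ≤ (√(2 * Real.pi))⁻¹ * (Real.exp (-a ^ 2 / 2) / a) := by
  have hd : ∀ x ∈ Set.Ici a, HasDerivAt (fun x : ℝ => -(Real.exp (-x ^ 2 / 2) / a))
      (x / a * Real.exp (-x ^ 2 / 2)) x := by
    intro x _
    have h : HasDerivAt (fun x : ℝ => -x ^ 2 / 2) (-x) x := by
      convert! ((hasDerivAt_pow 2 x).neg.div_const 2) using 1
      simp; ring
    convert! (h.exp.div_const a).neg using 1
    ring
  have hpos : ∀ x ∈ Set.Ioi a, 0 ≤ x / a * Real.exp (-x ^ 2 / 2) := fun x hx =>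
    mul_nonneg (div_nonneg (ha.trans hx).le ha.le) (Real.exp_pos _).le
  have hlim : Filter.Tendsto (fun x : ℝ => -(Real.exp (-x ^ 2 / 2) / a)) Filter.atTop
      (nhds 0) := by
    have h1 : Filter.Tendsto (fun x : ℝ => -x ^ 2 / 2) Filter.atTop Filter.atBot := by
      have := (Filter.tendsto_pow_atTop (α := ℝ) two_ne_zero).atTop_div_const (r := 2) two_pos
      refine (Filter.tendsto_neg_atTop_atBot.comp this).congr fun x => ?_
      simp [neg_div]
    simpa using ((Real.tendsto_exp_atBot.comp h1).div_const a).neg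
  have hint := integrableOn_Ioi_deriv_of_nonneg' hd hpos hlim
  have heq := integral_Ioi_of_hasDerivAt_of_tendsto' hd hint hlim
  rw [measureReal_def, gaussianReal_apply_eq_integral 0 one_ne_zero, ENNReal.toReal_ofReal
    (setIntegral_nonneg measurableSet_Ioi fun x _ => gaussianPDFReal_nonneg _ _ _)]
  calc ∫ x in Set.Ioi a, gaussianPDFReal 0 1 x
      ≤ ∫ x in Set.Ioi a, (√(2 * Real.pi))⁻¹ * (x / a * Real.exp (-x ^ 2 / 2)) := by
        refine setIntegral_mono_on (integrable_gaussianPDFReal 0 1).integrableOn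
          (hint.const_mul _) measurableSet_Ioi fun x hx => ?_
        -- Inserting the factor x / a ≥ 1 turns the density into an exact derivative.
        have h1 : 1 ≤ x / a := (one_le_div ha).2 (le_of_lt hx)
        simp only [gaussianPDFReal, NNReal.coe_one, mul_one, sub_zero]
        gcongr
        exact le_mul_of_one_le_left (Real.exp_pos _).le h1
    _ = (√(2 * Real.pi))⁻¹ * (Real.exp (-a ^ 2 / 2) / a) := by
        rw [integral_const_mul, heq]; simp

/-- Two-sided tail bound for a centred Gaussian. -/
lemma gaussianReal_real_abs_ge_le {v : NNReal} {a c : ℝ} (ha : 0 < a) (hc : 0 < c)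
    (hac : √v * a ≤ c) :
    (gaussianReal 0 v).real {x | c ≤ |x|}
      ≤ 2 * ((√(2 * Real.pi))⁻¹ * (Real.exp (-a ^ 2 / 2) / a)) := by
  have h1 : gaussianReal 0 v = (gaussianReal 0 1).map (fun x => √v * x) := by
    rw [gaussianReal_map_const_mul]
    congr 1
    · simp
    · ext; simp
  have hneg : (gaussianReal 0 1).real (Set.Iio (-a)) = (gaussianReal 0 1).real (Set.Ioi a) := by
    have h : (gaussianReal 0 1).map (fun x : ℝ => -x) = gaussianReal 0 1 := by
      simpa using gaussianReal_map_neg (μ := 0) (v := 1)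
    conv_lhs => rw [← h]
    rw [map_measureReal_apply measurable_neg measurableSet_Iio]
    congr 1
    ext x; simp
  have hms : MeasurableSet {x : ℝ | c ≤ |x|} := measurableSet_le measurable_const measurable_norm
  rw [h1, map_measureReal_apply (measurable_const_mul _) hms]
  have hset : (fun x => √v * x) ⁻¹' {x : ℝ | c ≤ |x|} ⊆ Set.Ici a ∪ Set.Iic (-a) := by
    intro z hz
    simp only [Set.mem_preimage, Set.mem_ofPred_eq, abs_mul, abs_of_nonneg (Real.sqrt_nonneg _)] at hz
    -- Zero variance is allowed; the tail set is then empty because 0 < c.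
    have hv : 0 < √(v : ℝ) := by
      rcases (Real.sqrt_nonneg (v : ℝ)).lt_or_eq with h | h
      · exact h
      · rw [← h] at hz; linarith
    have : a ≤ |z| := le_of_mul_le_mul_left (hac.trans hz) hv
    rcases le_abs.1 this with h | h
    · exact Or.inl h
    · exact Or.inr (by simp only [Set.mem_Iic]; linarith)
  have hna := nullSingletonClass_gaussianReal (μ := 0) (one_ne_zero : (1 : NNReal) ≠ 0)
  calc (gaussianReal 0 1).real ((fun x => √v * x) ⁻¹' {x : ℝ | c ≤ |x|})
      ≤ (gaussianReal 0 1).real (Set.Ici a ∪ Set.Iic (-a)) := measureReal_mono hset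
    _ ≤ (gaussianReal 0 1).real (Set.Ici a) + (gaussianReal 0 1).real (Set.Iic (-a)) :=
        measureReal_union_le _ _
    _ = 2 * (gaussianReal 0 1).real (Set.Ioi a) := by
        rw [measureReal_congr (Ioi_ae_eq_Ici (a := a)).symm,
          measureReal_congr (Iio_ae_eq_Iic (a := -a)).symm, hneg, two_mul]
    _ ≤ _ := by gcongr; exact gaussianReal_real_Ioi_le ha

/-- At level 2√(log p) the exponential equals p⁻². The union bound over p forms costs one factor p,
and a factor 2√2 is given away. -/
lemma mul_gaussian_tail_le {p : ℕ} (hp : 2 ≤ p) :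
    p * (2 * ((√(2 * Real.pi))⁻¹ * (Real.exp (-(2 * √(Real.log p)) ^ 2 / 2)
      / (2 * √(Real.log p))))) ≤ 2 / ((p : ℝ) * √(Real.pi * Real.log p)) := by
  have hp' : (1 : ℝ) < p := by exact_mod_cast hp
  have hp0 : (0 : ℝ) < p := by linarith
  have hl : 0 < Real.log p := Real.log_pos hp'
  have hexp : Real.exp (-(2 * √(Real.log p)) ^ 2 / 2) = ((p : ℝ) ^ 2)⁻¹ := by
    rw [mul_pow, Real.sq_sqrt hl.le, show -(2 ^ 2 * Real.log p) / 2 = -((2 : ℕ) * Real.log p) by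
      push_cast; ring, Real.exp_neg, ← Real.log_pow, Real.exp_log (by positivity)]
  rw [hexp, Real.sqrt_mul (by norm_num), Real.sqrt_mul Real.pi_pos.le]
  have h2 : (√2)⁻¹ ≤ (1 : ℝ) := inv_le_one_of_one_le₀ (by
    rw [Real.one_le_sqrt]; norm_num)
  have hspi : 0 < √Real.pi := Real.sqrt_pos.2 Real.pi_pos
  have hsl : 0 < √(Real.log p) := Real.sqrt_pos.2 hl
  have e1 : p * (2 * ((√2 * √Real.pi)⁻¹ * (((p : ℝ) ^ 2)⁻¹ / (2 * √(Real.log p)))))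
      = (√2)⁻¹ * (1 / ((p : ℝ) * (√Real.pi * √(Real.log p)))) := by
    field_simp
  rw [e1]
  have h3 : 0 ≤ 1 / ((p : ℝ) * (√Real.pi * √(Real.log p))) := by positivity
  calc (√2)⁻¹ * (1 / ((p : ℝ) * (√Real.pi * √(Real.log p))))
      ≤ 1 * (1 / ((p : ℝ) * (√Real.pi * √(Real.log p)))) := by gcongr
    _ ≤ 2 / ((p : ℝ) * (√Real.pi * √(Real.log p))) := by
        rw [one_mul]; gcongr; norm_num

section Noise

variable {Ω : Type*} [MeasurableSpace Ω] {P : Measure Ω}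
  {n : ℕ} {σ : ℝ} {ε : Ω → Fin n → ℝ}

lemma hasLaw_noise_sum
    (hε : HasLaw ε (Measure.pi fun _ : Fin n => gaussianReal 0 (Real.toNNReal (σ ^ 2))) P)
    (a : Fin n → ℝ) :
    HasLaw (fun ω => ∑ k, a k * ε ω k)
      (gaussianReal 0 (Real.toNNReal (σ ^ 2) * Real.toNNReal (∑ k, a k ^ 2))) P :=
  (hasLaw_pi_gaussianReal_sum _ a).comp hε

lemma integrable_noise_sum
    (hε : HasLaw ε (Measure.pi fun _ : Fin n => gaussianReal 0 (Real.toNNReal (σ ^ 2))) P)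
    (a : Fin n → ℝ) : Integrable (fun ω => ∑ k, a k * ε ω k) P := by
  have h := hasLaw_noise_sum hε a
  have h1 : Integrable id (P.map (fun ω => ∑ k, a k * ε ω k)) := by
    rw [h.map_eq]
    exact memLp_one_iff_integrable.1 (memLp_id_gaussianReal 1)
  exact (integrable_map_measure h1.aestronglyMeasurable h.aemeasurable).1 h1

lemma integral_noise_sum
    (hε : HasLaw ε (Measure.pi fun _ : Fin n => gaussianReal 0 (Real.toNNReal (σ ^ 2))) P)
    (a : Fin n → ℝ) : ∫ ω, ∑ k, a k * ε ω k ∂P = 0 := by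
  rw [(hasLaw_noise_sum hε a).integral_eq, integral_id_gaussianReal]

/-- With high probability `p` Gaussian linear forms stay below twice their standard deviation
times `√(log p)`. -/
lemma exists_event_abs_noise_sum_lt [IsProbabilityMeasure P] {p : ℕ} (hp : 2 ≤ p) (hσ : 0 < σ)
    (hε : HasLaw ε (Measure.pi fun _ : Fin n => gaussianReal 0 (Real.toNNReal (σ ^ 2))) P)
    (a : Fin p → Fin n → ℝ) (c : Fin p → ℝ) (hc : ∀ i, 0 < c i)
    (hac : ∀ i, σ * √(∑ k, a i k ^ 2) * (2 * √(Real.log p)) ≤ c i) :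
    ∃ E : Set Ω, MeasurableSet E ∧
      1 - 2 / ((p : ℝ) * √(Real.pi * Real.log p)) ≤ P.real E ∧
      ∀ ω ∈ E, ∀ i, |∑ k, a i k * ε ω k| < c i := by
  have hl : 0 < 2 * √(Real.log p) :=
    mul_pos two_pos (Real.sqrt_pos.2 (Real.log_pos (by exact_mod_cast hp)))
  let B : Set Ω := ⋃ i, {ω | c i ≤ |∑ k, a i k * ε ω k|}
  have hB : P.real B ≤ 2 / ((p : ℝ) * √(Real.pi * Real.log p)) := by
    refine (measureReal_iUnion_fintype_le _).trans (le_trans ?_ (mul_gaussian_tail_le hp))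
    refine (Finset.sum_le_card_nsmul _ _ _ fun i _ => ?_).trans_eq
      (by rw [Finset.card_univ, Fintype.card_fin, nsmul_eq_mul])
    rw [(hasLaw_noise_sum hε (a i)).measureReal_eq (p := fun x => c i ≤ |x|)
      (measurableSet_le measurable_const measurable_norm)]
    refine gaussianReal_real_abs_ge_le hl (hc i) (le_trans (le_of_eq ?_) (hac i))
    rw [NNReal.coe_mul, Real.coe_toNNReal _ (sq_nonneg σ),
      Real.coe_toNNReal _ (Finset.sum_nonneg fun k _ => sq_nonneg _),
      Real.sqrt_mul (sq_nonneg σ), Real.sqrt_sq hσ.le]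
  -- The noise is only almost everywhere measurable, so the bad set is enlarged to a measurable one
  -- of equal measure.
  refine ⟨(toMeasurable P B)ᶜ, (measurableSet_toMeasurable P B).compl, ?_, fun ω hω i => ?_⟩
  · rw [probReal_compl_eq_one_sub (measurableSet_toMeasurable P B), measureReal_def,
      measure_toMeasurable, ← measureReal_def]
    linarith
  · by_contra h
    exact hω (subset_toMeasurable P B (Set.mem_iUnion.2 ⟨i, not_lt.1 h⟩))

end Noise

/-! ### Subgradients, basic properties of paths, no false positives -/

/-- The negative gradient `(1/n) Xᵀ (y - X c)` of the least squares loss. -/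
noncomputable def residGrad {n p : ℕ} (X : Matrix (Fin n) (Fin p) ℝ) (y : Fin n → ℝ)
    (c : Fin p → ℝ) : Fin p → ℝ := (1 / (n : ℝ)) • (X.transpose.mulVec (y - X.mulVec c))

/-- The ℓ¹-norm is separable, so changing one coordinate at a time suffices. The test values 0 and
2b_i give the equality, and ±1 then give the bound. -/
lemma mem_subdiffL1_iff {p : ℕ} {b g : Fin p → ℝ} :
    g ∈ subdiffL1 b ↔ ∀ i, |g i| ≤ 1 ∧ g i * b i = |b i| := by
  constructor
  · intro h i
    have key : ∀ v : ℝ, |b i| + g i * (v - b i) ≤ |v| := by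
      intro v
      have h1 := h (Function.update b i v)
      simp only [l1norm, ← Finset.sum_add_distrib] at h1
      rw [← sub_nonpos, ← Finset.sum_sub_distrib, Finset.sum_eq_single i] at h1
      · simpa using h1
      · intro j _ hj
        simp [Function.update_of_ne hj]
      · simp
    have h0 := key 0
    have h2 := key (2 * b i)
    have h3 : |2 * b i| = 2 * |b i| := by rw [abs_mul, abs_two]
    have heq : g i * b i = |b i| := by
      rw [h3] at h2; rw [abs_zero] at h0; linarith
    refine ⟨abs_le.2 ⟨?_, ?_⟩, heq⟩
    · have := key (-1); rw [abs_neg, abs_one] at this; linarith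
    · have := key 1; rw [abs_one] at this; linarith
  · intro h z
    simp only [l1norm, ← Finset.sum_add_distrib]
    refine Finset.sum_le_sum fun i _ => ?_
    have h1 : g i * z i ≤ |z i| := by
      calc g i * z i ≤ |g i * z i| := le_abs_self _
        _ = |g i| * |z i| := abs_mul _ _
        _ ≤ 1 * |z i| := by gcongr; exact (h i).1
        _ = |z i| := one_mul _
    linarith [(h i).2]

namespace IsPath

variable {n p : ℕ} {X : Matrix (Fin n) (Fin p) ℝ} {y : Fin n → ℝ} {β ρ : ℝ → Fin p → ℝ}

lemma abs_rho_le (h : IsPath X y β ρ) {t : ℝ} (ht : 0 ≤ t) (i : Fin p) : |ρ t i| ≤ 1 :=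
  (mem_subdiffL1_iff.1 (h.rho_mem t ht) i).1

lemma rho_mul_beta (h : IsPath X y β ρ) {t : ℝ} (ht : 0 ≤ t) (i : Fin p) :
    ρ t i * β t i = |β t i| :=
  (mem_subdiffL1_iff.1 (h.rho_mem t ht) i).2

lemma beta_eq_zero (h : IsPath X y β ρ) {t : ℝ} (ht : 0 ≤ t) {i : Fin p} (hi : |ρ t i| < 1) :
    β t i = 0 := by
  by_contra hne
  have h1 := congrArg abs (h.rho_mul_beta ht i)
  rw [abs_mul, abs_abs] at h1
  have := abs_pos.2 hne
  nlinarith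

lemma hasDerivWithinAt_rho (h : IsPath X y β ρ) {t : ℝ} (ht : 0 ≤ t) (i : Fin p) :
    HasDerivWithinAt (fun s => ρ s i) (residGrad X y (β t) i) (Set.Ici t) t :=
  hasDerivWithinAt_pi.1 (h.rho_rightDeriv t ht) i

lemma continuousOn_rho (h : IsPath X y β ρ) (i : Fin p) :
    ContinuousOn (fun s => ρ s i) (Set.Ici 0) :=
  (continuous_apply i).comp_continuousOn h.rho_continuous

/-- On the support of `β_t` the dual path is locally constant to the right. -/
lemma residGrad_mul_beta (h : IsPath X y β ρ) {t : ℝ} (ht : 0 ≤ t) (i : Fin p) :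
    residGrad X y (β t) i * β t i = 0 := by
  by_cases hne : β t i = 0
  · rw [hne, mul_zero]
  have hcont : ContinuousWithinAt (fun s => β s i) (Set.Ici t) t :=
    (continuous_apply i).continuousAt.comp_continuousWithinAt (h.beta_rightContinuous t ht)
  have hev : ∀ᶠ s in nhdsWithin t (Set.Ici t), 0 < β s i * β t i := by
    have : ContinuousWithinAt (fun s => β s i * β t i) (Set.Ici t) t :=
      hcont.mul continuousWithinAt_const
    exact this.eventually (lt_mem_nhds (mul_self_pos.2 hne))
  -- By right continuity the sign of β_i persists for a while, and ρ_i equals that sign.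
  have hconst : (fun s => ρ s i) =ᶠ[nhdsWithin t (Set.Ici t)] fun _ => ρ t i := by
    filter_upwards [hev, self_mem_nhdsWithin] with s hs hts
    have h1 := h.rho_mul_beta ht i
    have h2 := h.rho_mul_beta (ht.trans hts) i
    rcases lt_or_gt_of_ne hne with hn | hn
    · have hsn : β s i < 0 := by nlinarith
      rw [abs_of_neg hn] at h1
      rw [abs_of_neg hsn] at h2
      rw [mul_right_cancel₀ hne (h1.trans (neg_one_mul _).symm),
        mul_right_cancel₀ hsn.ne (h2.trans (neg_one_mul _).symm)]
    · have hsn : 0 < β s i := by nlinarith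
      rw [abs_of_pos hn] at h1
      rw [abs_of_pos hsn] at h2
      rw [mul_right_cancel₀ hne (h1.trans (one_mul _).symm),
        mul_right_cancel₀ hsn.ne' (h2.trans (one_mul _).symm)]
  have hd0 : HasDerivWithinAt (fun s => ρ s i) 0 (Set.Ici t) t :=
    (hasDerivWithinAt_const t (Set.Ici t) (ρ t i)).congr_of_eventuallyEq hconst rfl
  have := (uniqueDiffWithinAt_Ici t).eq_deriv _ (h.hasDerivWithinAt_rho ht i) hd0
  rw [this, zero_mul]

/-- If off the support of `b` the gradient is a contraction of the gradient on the support plus a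
small constant, then the dual path stays strictly inside `[-1, 1]` off the support of `b`. -/
lemma abs_rho_lt_one (h : IsPath X y β ρ) {b : Fin p → ℝ} {A : Matrix (Cosupp b) (Supp b) ℝ}
    {w : Cosupp b → ℝ} {η τ : ℝ}
    (hgrad : ∀ c : Fin p → ℝ, (∀ j : Cosupp b, c j = 0) → ∀ j : Cosupp b,
      residGrad X y c j = ∑ i, A j i * residGrad X y c i + w j)
    (hA : ∀ j, ∑ i, |A j i| ≤ 1 - η) (hw : ∀ j, |w j| * τ < η)
    {t : ℝ} (ht0 : 0 ≤ t) (ht : t ≤ τ) (j : Cosupp b) : |ρ t j| < 1 := by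
  by_contra hj
  let B : Set ℝ := ⋃ j : Cosupp b, {t ∈ Set.Icc 0 τ | 1 ≤ |ρ t j|}
  have hcontIcc : ∀ (r : ℝ) (i : Fin p), ContinuousOn (fun s => ρ s i) (Set.Icc 0 r) :=
    fun r i => (h.continuousOn_rho i).mono Set.Icc_subset_Ici_self
  have hBclosed : IsClosed B := isClosed_iUnion_of_finite fun j =>
    isClosed_Icc.isClosed_le continuousOn_const (hcontIcc τ j).abs
  have hBc : IsCompact B := (isCompact_Icc (a := (0 : ℝ)) (b := τ)).of_isClosed_subset hBclosed
    (Set.iUnion_subset fun j => Set.sep_subset _ _)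
  -- The first time some dual coordinate off the support reaches ±1; before it, β vanishes there and
  -- `hgrad` applies.
  obtain ⟨t0, ht0B, hmin⟩ := hBc.exists_isLeast
    ⟨t, Set.mem_iUnion.2 ⟨j, ⟨ht0, ht⟩, not_lt.1 hj⟩⟩
  obtain ⟨k, ⟨hk0, hkτ⟩, hk⟩ := Set.mem_iUnion.1 ht0B
  have hlt : ∀ s ∈ Set.Ico 0 t0, ∀ j : Cosupp b, β s j = 0 := by
    intro s hs j
    refine h.beta_eq_zero hs.1 (not_le.1 fun hle => ?_)
    exact absurd (hmin (Set.mem_iUnion.2 ⟨j, ⟨hs.1, hs.2.le.trans hkτ⟩, hle⟩)) (not_le.2 hs.2)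
  -- Integrated form of `hgrad`: ρ_k = Σ A_ki ρ_i + t w_k on [0, t0].
  have hconst := constant_of_has_deriv_right_zero
    (f := fun s => ρ s k - (∑ i : Supp b, A k i * ρ s i + s * w k)) (a := 0) (b := t0)
    ((hcontIcc t0 k).sub (ContinuousOn.add (continuousOn_finsetSum Finset.univ fun i _ =>
      continuousOn_const.mul (hcontIcc t0 i)) (by fun_prop)))
    (fun s hs => by
      have h1 := (h.hasDerivWithinAt_rho hs.1 k).sub ((HasDerivWithinAt.fun_sum
        (u := Finset.univ) fun i _ =>
          (h.hasDerivWithinAt_rho hs.1 (i : Supp b)).const_mul (A k i)).add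
        ((hasDerivWithinAt_id s _).mul_const (w k)))
      convert! h1 using 1
      rw [hgrad _ (hlt s hs) k, one_mul, sub_self])
    t0 ⟨hk0, le_rfl⟩
  simp only [h.rho_zero, Pi.zero_apply, mul_zero, Finset.sum_const_zero, zero_mul, add_zero,
    sub_zero, sub_eq_zero] at hconst
  rw [hconst] at hk
  have h2 : |∑ i : Supp b, A k i * ρ t0 i| ≤ 1 - η := by
    refine (Finset.abs_sum_le_sum_abs _ _).trans ((Finset.sum_le_sum fun i _ => ?_).trans (hA k))
    rw [abs_mul]
    exact mul_le_of_le_one_right (abs_nonneg _) (h.abs_rho_le hk0 i)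
  have h3 : |t0 * w k| ≤ |w k| * τ := by
    rw [abs_mul, abs_of_nonneg hk0, mul_comm]; gcongr
  linarith [abs_add_le (∑ i : Supp b, A k i * ρ t0 i) (t0 * w k), hw k]

end IsPath

/-! ### Finite-time extinction of the Bregman distance -/

lemma sub_le_of_hasDerivWithinAt_le {f f' : ℝ → ℝ} {a b c : ℝ} (hab : a ≤ b)
    (hf : ContinuousOn f (Set.Icc a b))
    (hf' : ∀ x ∈ Set.Ico a b, HasDerivWithinAt f (f' x) (Set.Ici x) x)
    (hc : ∀ x ∈ Set.Ico a b, f' x ≤ -c) : f b ≤ f a - c * (b - a) := by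
  have hB : ∀ x, HasDerivAt (fun x => f a - c * (x - a)) (-c) x := fun x => by
    simpa using (((hasDerivAt_id x).sub_const a).const_mul c).const_sub (f a)
  exact image_le_of_deriv_right_le_deriv_boundary hf hf' (B := fun x => f a - c * (x - a))
    (by simp) (fun x _ => (hB x).continuousAt.continuousWithinAt)
    (fun x _ => (hB x).hasDerivWithinAt) hc ⟨hab, le_rfl⟩

/-- Finite-time extinction for a differential inequality of Bihari type. -/
lemma exists_eq_zero_of_bihari {D D' x : ℝ → ℝ} {γ m s τ : ℝ} (hγ : 0 < γ) (hm : 0 < m)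
    (hs : 1 ≤ s) (hτ : 2 * (2 + Real.log s) / (γ * m) ≤ τ)
    (hcont : ContinuousOn D (Set.Icc 0 τ)) (hD0 : ∀ t ∈ Set.Icc 0 τ, 0 ≤ D t)
    (hderiv : ∀ t ∈ Set.Ico 0 τ, HasDerivWithinAt D (D' t) (Set.Ici t) t)
    (hle : ∀ t ∈ Set.Ico 0 τ, D' t ≤ -(γ * x t))
    (hx0 : ∀ t ∈ Set.Ico 0 τ, 0 < D t → m ^ 2 ≤ x t)
    (hx1 : ∀ t ∈ Set.Ico 0 τ, D t * m ≤ 2 * x t)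
    (hx2 : ∀ t ∈ Set.Ico 0 τ, D t ^ 2 ≤ 4 * s * x t) : D τ = 0 := by
  have hlog : 0 ≤ Real.log s := Real.log_nonneg hs
  have hs0 : 0 < s := by linarith
  have hγm : 0 < γ * m := mul_pos hγ hm
  have hτ0 : 0 ≤ τ := le_trans (by positivity) hτ
  by_contra hne
  have hpos : 0 < D τ := lt_of_le_of_ne (hD0 τ ⟨hτ0, le_rfl⟩) (Ne.symm hne)
  have hxnn : ∀ t ∈ Set.Ico 0 τ, 0 ≤ x t := fun t ht => by
    nlinarith [hx2 t ht, sq_nonneg (D t)]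
  -- D is nonincreasing, so positivity at τ propagates backwards; this licenses 1/D and log D below.
  have hDpos : ∀ t ∈ Set.Icc 0 τ, 0 < D t := fun t ht => by
    have := sub_le_of_hasDerivWithinAt_le (c := 0) ht.2
      (hcont.mono (Set.Icc_subset_Icc_left ht.1)) (fun s hs => hderiv s ⟨ht.1.trans hs.1, hs.2⟩)
      (fun s hs => (hle s ⟨ht.1.trans hs.1, hs.2⟩).trans (by
        have := mul_nonneg hγ.le (hxnn s ⟨ht.1.trans hs.1, hs.2⟩); linarith))
    linarith
  -- Three regimes, one per lower bound on x. The quadratic bound makes 1/D grow until D < 2sm,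
  -- whatever D(0) is; the linear one gives exponential decay down to 2m in time 2 log s/(γm); the
  -- constant one then removes 2m at rate γm². The durations add up to 2(2 + log s)/(γm).
  set t1 := 2 / (γ * m) with ht1
  set t2 := t1 + 2 * Real.log s / (γ * m) with ht2
  set t3 := t2 + 2 / (γ * m) with ht3
  have ht10 : 0 < t1 := by positivity
  have ht12 : t1 ≤ t2 := le_add_of_nonneg_right (by positivity)
  have ht23 : t2 < t3 := lt_add_of_pos_right _ (by positivity)
  have ht3τ : t3 ≤ τ := le_trans (le_of_eq (by rw [ht3, ht2, ht1]; field_simp; ring)) hτ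
  have sub : ∀ {a b : ℝ}, 0 ≤ a → b ≤ τ → Set.Icc a b ⊆ Set.Icc 0 τ := fun ha hb =>
    Set.Icc_subset_Icc ha hb
  have sub' : ∀ {a b : ℝ}, 0 ≤ a → b ≤ τ → Set.Ico a b ⊆ Set.Ico 0 τ := fun ha hb =>
    Set.Ico_subset_Ico ha hb
  have phase1 : D t1 < 2 * s * m := by
    have hsub := sub le_rfl ((ht12.trans ht23.le).trans ht3τ)
    have hsub' := sub' le_rfl ((ht12.trans ht23.le).trans ht3τ)
    have := sub_le_of_hasDerivWithinAt_le (f := fun t => -(D t)⁻¹) (c := γ / (4 * s)) ht10.le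
      ((hcont.mono hsub).inv₀ fun t ht => (hDpos t (hsub ht)).ne').neg
      (fun t ht => ((hderiv t (hsub' ht)).fun_inv
        (hDpos t (Set.Ico_subset_Icc_self (hsub' ht))).ne').neg)
      (fun t ht => by
        have hd := hDpos t (Set.Ico_subset_Icc_self (hsub' ht))
        have h2 := hx2 t (hsub' ht)
        have h1 := hle t (hsub' ht)
        rw [neg_div, neg_neg, div_le_iff₀ (by positivity), neg_mul, div_mul_eq_mul_div]
        refine h1.trans (neg_le_neg ?_)
        rw [div_le_iff₀ (by positivity)]
        nlinarith)
    have h0 := inv_pos.2 (hDpos 0 ⟨le_rfl, hτ0⟩)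
    have e : γ / (4 * s) * (t1 - 0) = (2 * s * m)⁻¹ := by rw [ht1]; field_simp; ring
    rw [e] at this
    exact (inv_lt_inv₀ (by positivity) (hDpos t1 (hsub ⟨ht10.le, le_rfl⟩))).1 (by linarith)
  have phase2 : D t2 < 2 * m := by
    have hsub := sub ht10.le (ht23.le.trans ht3τ)
    have hsub' := sub' ht10.le (ht23.le.trans ht3τ)
    have := sub_le_of_hasDerivWithinAt_le (f := fun t => Real.log (D t)) (c := γ * m / 2) ht12
      ((hcont.mono hsub).log fun t ht => (hDpos t (hsub ht)).ne')
      (fun t ht => (hderiv t (hsub' ht)).log (hDpos t (Set.Ico_subset_Icc_self (hsub' ht))).ne')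
      (fun t ht => by
        have hd := hDpos t (Set.Ico_subset_Icc_self (hsub' ht))
        have h2 := hx1 t (hsub' ht)
        have h1 := hle t (hsub' ht)
        rw [div_le_iff₀ hd]
        nlinarith)
    have e : γ * m / 2 * (t2 - t1) = Real.log s := by rw [ht2]; field_simp; ring
    rw [e] at this
    have hl1 := Real.log_lt_log (hDpos t1 (hsub ⟨le_rfl, ht12⟩)) phase1
    rw [show 2 * s * m = (2 * m) * s by ring, Real.log_mul (by positivity) hs0.ne'] at hl1
    exact (Real.log_lt_log_iff (hDpos t2 (hsub ⟨ht12, le_rfl⟩)) (by positivity)).1 (by linarith)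
  have hsub := sub (ht10.le.trans ht12) ht3τ
  have hsub' := sub' (ht10.le.trans ht12) ht3τ
  have phase3 := sub_le_of_hasDerivWithinAt_le (c := γ * m ^ 2) ht23.le (hcont.mono hsub)
    (fun t ht => hderiv t (hsub' ht))
    (fun t ht => by
      have h2 := hx0 t (hsub' ht) (hDpos t (Set.Ico_subset_Icc_self (hsub' ht)))
      have h1 := hle t (hsub' ht)
      nlinarith)
  have e : γ * m ^ 2 * (t3 - t2) = 2 * m := by rw [ht3]; field_simp; ring
  have := hDpos t3 (hsub ⟨ht23.le, le_rfl⟩)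
  linarith

/-- The coordinatewise Bregman distance vanishes unless `v` is at least as far from `u` as `0`. -/
lemma abs_sub_mul_eq_zero_or {u v r : ℝ} (hr : |r| ≤ 1) (hrv : r * v = |v|) :
    |u| - r * u = 0 ∨ (|u| - r * u ≤ 2 * |u| ∧ |u| ≤ |u - v|) := by
  obtain ⟨hr1, hr2⟩ := abs_le.1 hr
  rcases lt_or_ge 0 (u * v) with huv | huv
  · left
    rcases lt_trichotomy v 0 with hv | hv | hv
    · have hu : u < 0 := by nlinarith
      rw [abs_of_neg hv] at hrv
      rw [mul_right_cancel₀ hv.ne (hrv.trans (neg_one_mul _).symm), abs_of_neg hu]; ring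
    · simp [hv] at huv
    · have hu : 0 < u := by nlinarith
      rw [abs_of_pos hv] at hrv
      rw [mul_right_cancel₀ hv.ne' (hrv.trans (one_mul _).symm), abs_of_pos hu]; ring
  · right
    constructor
    · have : |r * u| ≤ |u| := by
        rw [abs_mul]; exact mul_le_of_le_one_left (abs_nonneg _) hr
      linarith [neg_abs_le (r * u)]
    · rw [← sq_le_sq]; nlinarith [sq_nonneg v]

lemma sum_eq_sum_supp {p : ℕ} {b f : Fin p → ℝ} (hf : ∀ j : Cosupp b, f j = 0) :
    ∑ i, f i = ∑ i : Supp b, f i := by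
  rw [← Fintype.sum_subtype_add_sum_subtype (fun i => b i = 0) f,
    Finset.sum_eq_zero fun j _ => hf j, zero_add]

/-- A path that stays on the support of `b` has reached its target `u` after the time
`2 (2 + log s) / (γ m)`. -/
lemma IsPath.beta_eq_of_le {n p : ℕ} {X : Matrix (Fin n) (Fin p) ℝ} {y : Fin n → ℝ}
    {β ρ : ℝ → Fin p → ℝ} (h : IsPath X y β ρ) {b u : Fin p → ℝ} {γ m τ : ℝ}
    (hγ : 0 < γ) (hm : 0 < m) (hτ0 : 0 ≤ τ)
    (hβ : ∀ t ∈ Set.Icc 0 τ, ∀ j : Cosupp b, β t j = 0) (hu : ∀ j : Cosupp b, u j = 0)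
    (hum : ∀ i : Supp b, m ≤ |u i|)
    (hstrong : ∀ c : Fin p → ℝ, (∀ j : Cosupp b, c j = 0) →
      γ * ∑ i, (u i - c i) ^ 2 ≤ ∑ i, residGrad X y c i * (u i - c i))
    (hτ : 2 * (2 + Real.log (Fintype.card (Supp b))) / (γ * m) ≤ τ) : β τ = u := by
  -- The extinction lemma needs s ≥ 1; for empty support both sides are zero.
  rcases Nat.eq_zero_or_pos (Fintype.card (Supp b)) with hs | hs
  · ext i
    have hi : b i = 0 := by
      by_contra hi
      exact (Fintype.card_eq_zero_iff.1 hs).false ⟨i, hi⟩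
    rw [hβ τ ⟨hτ0, le_rfl⟩ ⟨i, hi⟩, hu ⟨i, hi⟩]
  -- Since ρ_i β_i = |β_i|, this is the i-th summand of the Bregman distance ‖u‖₁ - ‖β‖₁ - ⟨ρ, u -
  -- β⟩.
  set d : ℝ → Fin p → ℝ := fun t i => |u i| - ρ t i * u i with hd
  set x : ℝ → ℝ := fun t => ∑ i, (u i - β t i) ^ 2 with hx
  have hdnn : ∀ t, 0 ≤ t → ∀ i, 0 ≤ d t i := fun t ht i => by
    have : |ρ t i * u i| ≤ |u i| := by
      rw [abs_mul]; exact mul_le_of_le_one_left (abs_nonneg _) (h.abs_rho_le ht i)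
    simp only [hd]; linarith [le_abs_self (ρ t i * u i)]
  have hdcase : ∀ t, 0 ≤ t → ∀ i,
      d t i = 0 ∨ (d t i ≤ 2 * |u i| ∧ |u i| ≤ |u i - β t i| ∧ m ≤ |u i|) := fun t ht i => by
    by_cases hi : b i = 0
    · left; simp [hd, hu ⟨i, hi⟩]
    · rcases abs_sub_mul_eq_zero_or (u := u i) (h.abs_rho_le ht i) (h.rho_mul_beta ht i) with h1 | h1
      · exact Or.inl h1
      · exact Or.inr ⟨h1.1, h1.2, hum ⟨i, hi⟩⟩
  have hderiv : ∀ t, 0 ≤ t → HasDerivWithinAt (fun t => ∑ i, d t i)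
      (-∑ i, residGrad X y (β t) i * (u i - β t i)) (Set.Ici t) t := fun t ht => by
    have h1 := HasDerivWithinAt.fun_sum (u := Finset.univ) fun i (_ : i ∈ Finset.univ) =>
      ((h.hasDerivWithinAt_rho ht i).mul_const (u i)).const_sub |u i|
    convert! h1 using 1
    rw [← Finset.sum_neg_distrib]
    refine Finset.sum_congr rfl fun i _ => ?_
    -- Because g_i β_i = 0, u may be replaced by u - β in the derivative, which makes strong
    -- convexity applicable.
    rw [mul_sub, h.residGrad_mul_beta ht i, sub_zero]
  have hle : ∀ t ∈ Set.Icc 0 τ,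
      -∑ i, residGrad X y (β t) i * (u i - β t i) ≤ -(γ * x t) := fun t ht =>
    neg_le_neg (hstrong _ (hβ t ht))
  have hDτ : ∑ i, d τ i = 0 := by
    refine exists_eq_zero_of_bihari (D := fun t => ∑ i, d t i) (x := x) hγ hm
      (s := (Fintype.card (Supp b) : ℝ)) (by exact_mod_cast hs) hτ ?_
      (fun t ht => Finset.sum_nonneg fun i _ => hdnn t ht.1 i) (fun t ht => hderiv t ht.1)
      (fun t ht => hle t (Set.Ico_subset_Icc_self ht)) ?_ ?_ ?_
    · exact (continuousOn_finsetSum _ fun i _ => continuousOn_const.sub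
        ((h.continuousOn_rho i).mul continuousOn_const)).mono Set.Icc_subset_Ici_self
    · intro t ht hpos
      obtain ⟨i, -, hi⟩ := Finset.exists_ne_zero_of_sum_ne_zero hpos.ne'
      obtain ⟨-, h2, h3⟩ := (hdcase t ht.1 i).resolve_left hi
      calc m ^ 2 ≤ |u i - β t i| ^ 2 := by gcongr; exact h3.trans h2
        _ = (u i - β t i) ^ 2 := sq_abs _
        _ ≤ x t := Finset.single_le_sum (f := fun i => (u i - β t i) ^ 2)
            (fun _ _ => sq_nonneg _) (Finset.mem_univ i)
    · intro t ht
      simp only [hx]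
      rw [Finset.sum_mul, Finset.mul_sum]
      refine Finset.sum_le_sum fun i _ => ?_
      rcases hdcase t ht.1 i with h0 | ⟨h1, h2, h3⟩
      · rw [h0, zero_mul]; positivity
      · rw [← sq_abs (u i - β t i)]
        nlinarith [abs_nonneg (u i)]
    · intro t ht
      have hbt := hβ t (Set.Ico_subset_Icc_self ht)
      have e1 : ∑ i, d t i ≤ 2 * ∑ i : Supp b, |u i - β t i| := by
        rw [sum_eq_sum_supp (b := b) fun j => by simp [hd, hu j], Finset.mul_sum]
        refine Finset.sum_le_sum fun i _ => ?_
        rcases hdcase t ht.1 i with h0 | ⟨h1, h2, -⟩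
        · rw [h0]; positivity
        · linarith
      have e2 : x t = ∑ i : Supp b, |u i - β t i| ^ 2 := by
        simp only [hx, sq_abs]
        exact sum_eq_sum_supp fun j => by simp [hu j, hbt j]
      have e3 := sq_sum_le_card_mul_sum_sq (s := Finset.univ)
        (f := fun i : Supp b => |u i - β t i|)
      rw [Finset.card_univ] at e3
      rw [e2]
      calc (∑ i, d t i) ^ 2 ≤ (2 * ∑ i : Supp b, |u i - β t i|) ^ 2 := by
            gcongr
            exact Finset.sum_nonneg fun i _ => hdnn t ht.1 i
        _ = 4 * (∑ i : Supp b, |u i - β t i|) ^ 2 := by ring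
        _ ≤ _ := by rw [mul_assoc]; gcongr
  -- D vanishes at τ and is nonnegative afterwards, so its right derivative at τ is nonnegative;
  -- combined with D' ≤ -γx this gives x(τ) = 0.
  have hDnn : 0 ≤ -∑ i, residGrad X y (β τ) i * (u i - β τ i) := by
    have hslope := (hasDerivWithinAt_iff_tendsto_slope' Set.self_notMem_Ioi).1
      ((hderiv τ hτ0).mono Set.Ioi_subset_Ici_self)
    refine ge_of_tendsto hslope ?_
    filter_upwards [self_mem_nhdsWithin] with s hs
    rw [slope_def_field, hDτ, sub_zero]
    exact div_nonneg (Finset.sum_nonneg fun i _ => hdnn s (hτ0.trans (le_of_lt hs)) i)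
      (sub_nonneg.2 (le_of_lt hs))
  have hx0 : x τ = 0 := by
    have h1 := hle τ ⟨hτ0, le_rfl⟩
    have h2 : 0 ≤ x τ := Finset.sum_nonneg fun _ _ => sq_nonneg _
    nlinarith
  ext i
  have := (Finset.sum_eq_zero_iff_of_nonneg fun _ _ => sq_nonneg _).1 hx0 i (Finset.mem_univ i)
  linarith [pow_eq_zero_iff (two_ne_zero) |>.1 this]

/-! ### Least squares on the support and the noise coefficients -/

section

variable {n p : ℕ} {X : Matrix (Fin n) (Fin p) ℝ} {b : Fin p → ℝ} {γ : ℝ}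

/-- The restriction of a vector to the support of `b`. -/
def resS (b : Fin p → ℝ) (c : Fin p → ℝ) : Supp b → ℝ := fun i => c i

lemma mulVec_eq_XS_mulVec {c : Fin p → ℝ} (hc : ∀ j : Cosupp b, c j = 0) :
    X *ᵥ c = XS X b *ᵥ resS b c := by
  ext k
  simp only [mulVec, dotProduct]
  rw [sum_eq_sum_supp (b := b) fun j => by rw [hc j, mul_zero]]
  rfl

lemma gramS_posDef (hγ : 0 < γ) (h : RestrictedStrongConvexity X b γ) : (gramS X b).PosDef := by
  have := Matrix.PosDef.posSemidef_add h ((Matrix.PosDef.one (n := Supp b) (R := ℝ)).smul hγ)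
  rwa [sub_add_cancel] at this

lemma gramS_isUnit_det (hγ : 0 < γ) (h : RestrictedStrongConvexity X b γ) :
    IsUnit (gramS X b).det :=
  (Matrix.isUnit_iff_isUnit_det _).1 (gramS_posDef hγ h).isUnit

lemma gramS_transpose : (gramS X b)ᵀ = gramS X b := by
  rw [gramS, transpose_smul, transpose_mul, transpose_transpose]

lemma le_dotProduct_gramS (h : RestrictedStrongConvexity X b γ) (v : Supp b → ℝ) :
    γ * ∑ i, v i ^ 2 ≤ v ⬝ᵥ (gramS X b *ᵥ v) := by
  have h1 := h.dotProduct_mulVec_nonneg v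
  rw [sub_mulVec, smul_mulVec, one_mulVec, dotProduct_sub, dotProduct_smul, star_trivial,
    sub_nonneg, smul_eq_mul] at h1
  refine le_trans (le_of_eq ?_) h1
  simp only [dotProduct, sq]

/-- Least squares coefficients on the support of `b`. -/
noncomputable def lsS (X : Matrix (Fin n) (Fin p) ℝ) (b : Fin p → ℝ) (z : Fin n → ℝ) :
    Supp b → ℝ := (gramS X b)⁻¹ *ᵥ ((1 / (n : ℝ)) • ((XS X b)ᵀ *ᵥ z))

lemma oracle_apply_supp (y : Fin n → ℝ) (i : Supp b) : oracle X b y i = lsS X b y i := by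
  simp only [oracle, dif_pos i.2, lsS]

lemma oracle_apply_cosupp (y : Fin n → ℝ) (j : Cosupp b) : oracle X b y j = 0 := by
  simp [oracle, j.2]

lemma resS_oracle (y : Fin n → ℝ) : resS b (oracle X b y) = lsS X b y :=
  funext fun i => oracle_apply_supp y i

lemma gramS_mulVec (v : Supp b → ℝ) :
    gramS X b *ᵥ v = (1 / (n : ℝ)) • ((XS X b)ᵀ *ᵥ (XS X b *ᵥ v)) := by
  rw [gramS, smul_mulVec, mulVec_mulVec]

lemma gramS_mulVec_lsS (hG : IsUnit (gramS X b).det) (z : Fin n → ℝ) :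
    gramS X b *ᵥ lsS X b z = (1 / (n : ℝ)) • ((XS X b)ᵀ *ᵥ z) := by
  rw [lsS, mulVec_mulVec, mul_nonsing_inv _ hG, one_mulVec]

lemma lsS_XS_mulVec_add (hG : IsUnit (gramS X b).det) (v : Supp b → ℝ) (e : Fin n → ℝ) :
    lsS X b (XS X b *ᵥ v + e) = v + lsS X b e := by
  rw [lsS, mulVec_add, smul_add, ← gramS_mulVec, mulVec_add, mulVec_mulVec,
    nonsing_inv_mul _ hG, one_mulVec, lsS]

/-- These are the normal equations: `lsS` is the point at which the restricted gradient vanishes. -/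
lemma resS_residGrad (hG : IsUnit (gramS X b).det) (y : Fin n → ℝ) {c : Fin p → ℝ}
    (hc : ∀ j : Cosupp b, c j = 0) :
    resS b (residGrad X y c) = gramS X b *ᵥ (lsS X b y - resS b c) := by
  rw [mulVec_sub, gramS_mulVec_lsS hG, gramS_mulVec, ← mulVec_eq_XS_mulVec hc, ← smul_sub,
    ← mulVec_sub]
  rfl

/-- The strong convexity of the loss along the support of `b`. -/
lemma mul_sum_sq_le_sum_residGrad_mul (hγ : 0 < γ) (h : RestrictedStrongConvexity X b γ)
    (y : Fin n → ℝ) {c : Fin p → ℝ} (hc : ∀ j : Cosupp b, c j = 0) :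
    γ * ∑ i, (oracle X b y i - c i) ^ 2
      ≤ ∑ i, residGrad X y c i * (oracle X b y i - c i) := by
  have h0 : ∀ j : Cosupp b, oracle X b y j - c j = 0 := fun j => by
    rw [oracle_apply_cosupp, hc, sub_zero]
  rw [sum_eq_sum_supp (b := b) fun j => by rw [h0 j]; simp,
    sum_eq_sum_supp (b := b) fun j => by rw [h0 j]; simp]
  refine (le_dotProduct_gramS h (resS b (oracle X b y) - resS b c)).trans_eq ?_
  rw [resS_oracle, ← resS_residGrad (gramS_isUnit_det hγ h) y hc, dotProduct_comm, ← resS_oracle]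
  rfl

/-- The residual projection `I - (1/n) X_S (X_S^* X_S)⁻¹ X_Sᵀ`. -/
noncomputable def residProj (X : Matrix (Fin n) (Fin p) ℝ) (b : Fin p → ℝ) :
    Matrix (Fin n) (Fin n) ℝ :=
  1 - (1 / (n : ℝ)) • (XS X b * (gramS X b)⁻¹ * (XS X b)ᵀ)

lemma residProj_mulVec (z : Fin n → ℝ) :
    residProj X b *ᵥ z = z - XS X b *ᵥ lsS X b z := by
  rw [residProj, sub_mulVec, one_mulVec, lsS, smul_mulVec, mulVec_smul, mulVec_smul,
    mulVec_mulVec, mulVec_mulVec]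

lemma residProj_transpose : (residProj X b)ᵀ = residProj X b := by
  rw [residProj, transpose_sub, transpose_one, transpose_smul, transpose_mul, transpose_mul,
    transpose_transpose, transpose_nonsing_inv, gramS_transpose, Matrix.mul_assoc]

lemma residProj_mul_self (hG : IsUnit (gramS X b).det) :
    residProj X b * residProj X b = residProj X b := by
  have key : (XS X b * (gramS X b)⁻¹ * (XS X b)ᵀ) *
      ((1 / (n : ℝ)) • (XS X b * (gramS X b)⁻¹ * (XS X b)ᵀ))
      = XS X b * (gramS X b)⁻¹ * (XS X b)ᵀ := by
    calc _ = XS X b * (gramS X b)⁻¹ * ((1 / (n : ℝ)) • ((XS X b)ᵀ * XS X b))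
          * (gramS X b)⁻¹ * (XS X b)ᵀ := by
          simp only [Matrix.mul_smul, Matrix.smul_mul, Matrix.mul_assoc]
      _ = _ := by
          rw [← gramS, Matrix.mul_assoc (XS X b), nonsing_inv_mul _ hG, Matrix.mul_one]
  rw [residProj]
  set R := (1 / (n : ℝ)) • (XS X b * (gramS X b)⁻¹ * (XS X b)ᵀ) with hR
  have hRR : R * R = R := by
    conv_lhs => rw [hR]
    rw [Matrix.smul_mul, ← hR, key]
  rw [Matrix.mul_sub, Matrix.sub_mul, Matrix.sub_mul, hRR]
  simp

/-- The gradient off the support of `b`, in terms of the gradient on the support. -/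
lemma residGrad_cosupp (hG : IsUnit (gramS X b).det) (e : Fin n → ℝ) {c : Fin p → ℝ}
    (hc : ∀ j : Cosupp b, c j = 0) (j : Cosupp b) :
    residGrad X (X *ᵥ b + e) c j
      = ∑ i, (((1 / (n : ℝ)) • ((XT X b)ᵀ * XS X b)) * (gramS X b)⁻¹) j i
          * residGrad X (X *ᵥ b + e) c i
        + ((1 / (n : ℝ)) • ((XT X b)ᵀ *ᵥ (residProj X b *ᵥ e))) j := by
  set y := X *ᵥ b + e with hy
  have h1 : ∑ i, (((1 / (n : ℝ)) • ((XT X b)ᵀ * XS X b)) * (gramS X b)⁻¹) j i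
          * residGrad X y c i
      = ((1 / (n : ℝ)) • ((XT X b)ᵀ *ᵥ (XS X b *ᵥ (lsS X b y - resS b c)))) j := by
    change ((((1 / (n : ℝ)) • ((XT X b)ᵀ * XS X b)) * (gramS X b)⁻¹)
      *ᵥ resS b (residGrad X y c)) j = _
    rw [resS_residGrad hG y hc, mulVec_mulVec, Matrix.mul_assoc, nonsing_inv_mul _ hG,
      Matrix.mul_one, smul_mulVec, ← mulVec_mulVec]
  -- Least squares reproduces the signal exactly, so the residual of y depends on the noise alone.
  have h2 : residProj X b *ᵥ e = y - XS X b *ᵥ lsS X b y := by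
    rw [residProj_mulVec, hy, mulVec_eq_XS_mulVec (b := b) (c := b) fun j => j.2,
      lsS_XS_mulVec_add hG, mulVec_add]
    abel
  have h3 : residGrad X y c j = ((1 / (n : ℝ)) • ((XT X b)ᵀ *ᵥ (y - X *ᵥ c))) j := rfl
  have h4 : y - XS X b *ᵥ resS b c
      = XS X b *ᵥ (lsS X b y - resS b c) + (y - XS X b *ᵥ lsS X b y) := by
    rw [mulVec_sub]; abel
  rw [h1, h2, h3, ← Pi.add_apply, ← smul_add, ← mulVec_add, mulVec_eq_XS_mulVec hc, h4]

/-- The coefficients of the noise in the oracle estimator (on the support of `b`) and in the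
dual path (off the support). -/
noncomputable def noiseCoeff (X : Matrix (Fin n) (Fin p) ℝ) (b : Fin p → ℝ) (i : Fin p) :
    Fin n → ℝ :=
  if h : b i ≠ 0 then (1 / (n : ℝ)) • ((gramS X b)⁻¹ * (XS X b)ᵀ) ⟨i, h⟩
  else (1 / (n : ℝ)) • (residProj X b *ᵥ fun k => X k i)

lemma sum_noiseCoeff_supp (i : Supp b) (e : Fin n → ℝ) :
    ∑ k, noiseCoeff X b i k * e k = lsS X b e i := by
  rw [lsS, mulVec_smul, mulVec_mulVec]
  simp only [noiseCoeff, dif_pos i.2]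
  simp only [Pi.smul_apply, mulVec, dotProduct, smul_eq_mul, Finset.mul_sum, mul_assoc]

lemma sum_noiseCoeff_cosupp (j : Cosupp b) (e : Fin n → ℝ) :
    ∑ k, noiseCoeff X b j k * e k
      = ((1 / (n : ℝ)) • ((XT X b)ᵀ *ᵥ (residProj X b *ᵥ e))) j := by
  simp only [noiseCoeff, j.2, ne_eq, not_true_eq_false, dif_neg, not_false_eq_true]
  change ((1 / (n : ℝ)) • (residProj X b *ᵥ fun k => X k j)) ⬝ᵥ e
    = (1 / (n : ℝ)) • ((fun k => X k j) ⬝ᵥ (residProj X b *ᵥ e))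
  rw [smul_dotProduct, dotProduct_mulVec, ← mulVec_transpose, residProj_transpose]

/-- A symmetric idempotent matrix does not increase Euclidean length. -/
lemma sum_sq_noiseCoeff_cosupp_le (hG : IsUnit (gramS X b).det) (j : Cosupp b) :
    ∑ k, noiseCoeff X b j k ^ 2 ≤ colNorm X j ^ 2 / n := by
  simp only [noiseCoeff, j.2, ne_eq, not_true_eq_false, dif_neg, not_false_eq_true]
  set x : Fin n → ℝ := fun k => X k j with hx
  set q := residProj X b *ᵥ x with hq
  have hxq : x ⬝ᵥ q = q ⬝ᵥ q := by
    have : q ⬝ᵥ q = x ⬝ᵥ (residProj X b *ᵥ q) := by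
      rw [dotProduct_mulVec, ← mulVec_transpose, residProj_transpose, dotProduct_comm]
    rw [this, hq, mulVec_mulVec, residProj_mul_self hG]
  have hle : q ⬝ᵥ q ≤ x ⬝ᵥ x := by
    have h1 : 0 ≤ (x - q) ⬝ᵥ (x - q) := by
      simp only [dotProduct]
      exact Finset.sum_nonneg fun k _ => mul_self_nonneg _
    rw [sub_dotProduct, dotProduct_sub, dotProduct_sub, dotProduct_comm q x, hxq] at h1
    linarith
  have h2 : colNorm X j ^ 2 = (1 / (n : ℝ)) * (x ⬝ᵥ x) := by
    rw [colNorm, Real.sq_sqrt (mul_nonneg (by positivity)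
      (Finset.sum_nonneg fun k _ => sq_nonneg _))]
    simp only [dotProduct, hx, sq]
  have h3 : ∑ k, ((1 / (n : ℝ)) • q) k ^ 2 = (1 / (n : ℝ)) * (1 / (n : ℝ)) * (q ⬝ᵥ q) := by
    simp only [dotProduct, Finset.mul_sum, Pi.smul_apply, smul_eq_mul]
    exact Finset.sum_congr rfl fun k _ => by ring
  rw [h3, h2]
  calc (1 / (n : ℝ)) * (1 / (n : ℝ)) * (q ⬝ᵥ q)
      ≤ (1 / (n : ℝ)) * (1 / (n : ℝ)) * (x ⬝ᵥ x) := by gcongr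
    _ = _ := by ring

/-- With G u = e_i the coefficient row is (1/n) X_S u, whose squared length is u_i / n. Strong
convexity gives γ u_i² ≤ ⟨u, G u⟩ = u_i, hence u_i ≤ 1/γ. -/
lemma sum_sq_noiseCoeff_supp_le (hγ : 0 < γ) (h : RestrictedStrongConvexity X b γ)
    (i : Supp b) : ∑ k, noiseCoeff X b i k ^ 2 ≤ 1 / (n * γ) := by
  have hG := gramS_isUnit_det hγ h
  set u : Supp b → ℝ := (gramS X b)⁻¹ *ᵥ Pi.single i 1 with hu
  have hGu : gramS X b *ᵥ u = Pi.single i 1 := by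
    rw [hu, mulVec_mulVec, mul_nonsing_inv _ hG, one_mulVec]
  have hui : u ⬝ᵥ (gramS X b *ᵥ u) = u i := by rw [hGu, dotProduct_single_one]
  have hlow : γ * u i ^ 2 ≤ u i := by
    rw [← hui]
    refine le_trans ?_ (le_dotProduct_gramS h u)
    rw [hui]
    gcongr
    exact Finset.single_le_sum (f := fun k => u k ^ 2) (fun _ _ => sq_nonneg _)
      (Finset.mem_univ i)
  have hule : u i ≤ 1 / γ := by
    rw [le_div_iff₀ hγ]
    by_contra hcon
    have hpos : 0 < u i := by nlinarith
    nlinarith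
  have hrow : noiseCoeff X b i = (1 / (n : ℝ)) • (XS X b *ᵥ u) := by
    simp only [noiseCoeff, dif_pos i.2]
    congr 1
    rw [hu, mulVec_mulVec, mulVec_single_one]
    ext k
    rw [col_apply, ← transpose_apply (XS X b * (gramS X b)⁻¹), transpose_mul,
      transpose_nonsing_inv, gramS_transpose]
  have hsum : ∑ k, noiseCoeff X b i k ^ 2 = (1 / (n : ℝ)) * u i := by
    rw [hrow, ← hui, gramS_mulVec, dotProduct_smul, smul_eq_mul, dotProduct_mulVec,
      vecMul_transpose]
    simp only [dotProduct, Finset.mul_sum, Pi.smul_apply, smul_eq_mul]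
    exact Finset.sum_congr rfl fun k _ => by ring
  rw [hsum, one_div (n * γ : ℝ), mul_inv, ← one_div, ← one_div γ]
  gcongr

lemma oracle_apply_supp_eq (hG : IsUnit (gramS X b).det) (e : Fin n → ℝ) (i : Supp b) :
    oracle X b (X *ᵥ b + e) i = b i + ∑ k, noiseCoeff X b i k * e k := by
  rw [oracle_apply_supp, mulVec_eq_XS_mulVec (b := b) (c := b) fun j => j.2,
    lsS_XS_mulVec_add hG, sum_noiseCoeff_supp]
  rfl

end

/-! ### Sign-constrained least squares -/

/-- Vectors that are nonpositive off `U` and nonnegative off `L`. -/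
def signCone {p : ℕ} (U L : Finset (Fin p)) : Set (Fin p → ℝ) :=
  {c | ∀ i, (i ∉ U → c i ≤ 0) ∧ (i ∉ L → 0 ≤ c i)}

/-- The residual sum of squares. -/
def rss {n p : ℕ} (X : Matrix (Fin n) (Fin p) ℝ) (y : Fin n → ℝ) (c : Fin p → ℝ) : ℝ :=
  ∑ k, (y - X *ᵥ c) k ^ 2

section Minimizer

variable {n p : ℕ} {X : Matrix (Fin n) (Fin p) ℝ} {y : Fin n → ℝ} {U L : Finset (Fin p)}

lemma zero_mem_signCone : (0 : Fin p → ℝ) ∈ signCone U L := fun _ => by simp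

lemma signCone_of_mul_nonneg {c d : Fin p → ℝ} (hc : c ∈ signCone U L)
    (h : ∀ i, 0 ≤ c i * d i) (h0 : ∀ i, c i = 0 → d i = 0) : d ∈ signCone U L := by
  intro i
  constructor
  · intro hi
    rcases ((hc i).1 hi).lt_or_eq with h1 | h1
    · nlinarith [h i]
    · exact (h0 i h1).le
  · intro hi
    rcases ((hc i).2 hi).lt_or_eq with h1 | h1
    · nlinarith [h i]
    · exact (h0 i h1.symm).ge

/-- Moving along a kernel direction kills a coordinate without leaving the orthant. -/
lemma exists_support_reduction {c d : Fin p → ℝ} (hneg : ∃ i, c i * d i < 0) :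
    ∃ s : ℝ, (∀ i, 0 ≤ c i * (c i + s * d i)) ∧ ∃ i, c i ≠ 0 ∧ c i + s * d i = 0 := by
  obtain ⟨j, hj⟩ := hneg
  -- Ratio test: among the coordinates that d drives towards zero, take the one that arrives first.
  obtain ⟨i, hi, hmin⟩ := (Finset.univ.filter fun i => c i * d i < 0).exists_min_image
    (fun i => -c i / d i) ⟨j, by simpa using hj⟩
  simp only [Finset.mem_filter, Finset.mem_univ, true_and] at hi hmin
  have hdi : d i ≠ 0 := fun h => by simp [h] at hi
  have hci : c i ≠ 0 := fun h => by simp [h] at hi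
  have hs : 0 < -c i / d i := by
    rw [div_eq_mul_inv, show -c i * (d i)⁻¹ = -(c i * d i) * ((d i)⁻¹) ^ 2 by field_simp]
    have := pow_pos (sq_pos_of_ne_zero (inv_ne_zero hdi)) 1
    rw [pow_one] at this
    exact mul_pos (by linarith) this
  refine ⟨-c i / d i, fun k => ?_, i, hci, by field_simp; ring⟩
  rcases lt_or_ge (c k * d k) 0 with hk | hk
  · have hm := hmin k hk
    have hdk : d k ≠ 0 := fun h => by simp [h] at hk
    have h1 : c k * d k * (-c k / d k) ≤ c k * d k * (-c i / d i) :=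
      mul_le_mul_of_nonpos_left hm hk.le
    have h2 : c k * d k * (-c k / d k) = -(c k * c k) := by field_simp
    nlinarith
  · nlinarith [mul_nonneg hk hs.le, mul_self_nonneg (c k)]

/-- Every point of the image of the cone is the image of a point of the cone that is supported on
linearly independent columns. -/
lemma exists_independent_representative {c : Fin p → ℝ} (hc : c ∈ signCone U L) :
    ∃ c' ∈ signCone U L, X *ᵥ c' = X *ᵥ c ∧
      ∀ d : Fin p → ℝ, (∀ i, c' i = 0 → d i = 0) → X *ᵥ d = 0 → d = 0 := by
  induction hN : (Finset.univ.filter fun i => c i ≠ 0).card using Nat.strong_induction_on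
    generalizing c with
  | _ N ih =>
    by_cases hind : ∀ d : Fin p → ℝ, (∀ i, c i = 0 → d i = 0) → X *ᵥ d = 0 → d = 0
    · exact ⟨c, hc, rfl, hind⟩
    push Not at hind
    obtain ⟨d, hd0, hXd, hdne⟩ := hind
    obtain ⟨d, hd0, hXd, hneg⟩ : ∃ d : Fin p → ℝ, (∀ i, c i = 0 → d i = 0) ∧ X *ᵥ d = 0 ∧
        ∃ i, c i * d i < 0 := by
      obtain ⟨i, hi⟩ := Function.ne_iff.1 hdne
      have hci : c i ≠ 0 := fun h => hi (hd0 i h)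
      rcases lt_or_gt_of_ne (mul_ne_zero hci hi) with h | h
      · exact ⟨d, hd0, hXd, i, h⟩
      · refine ⟨-d, fun j hj => by simp [hd0 j hj], by rw [mulVec_neg, hXd, neg_zero], i, ?_⟩
        simpa using h
    obtain ⟨s, hs, i, hci, hi⟩ := exists_support_reduction hneg
    have hX : X *ᵥ (c + s • d) = X *ᵥ c := by
      rw [mulVec_add, mulVec_smul, hXd, smul_zero, add_zero]
    have hz : ∀ j, c j = 0 → (c + s • d) j = 0 := fun j hj => by simp [hj, hd0 j hj]
    obtain ⟨c', h1, h2, h3⟩ := ih _ (by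
      rw [← hN]
      refine Finset.card_lt_card (Finset.ssubset_iff_of_subset ?_ |>.2 ⟨i, ?_, ?_⟩)
      · intro j hj
        simp only [Finset.mem_filter, Finset.mem_univ, true_and] at hj ⊢
        exact fun h => hj (hz j h)
      · simpa using hci
      · simpa using hi) (signCone_of_mul_nonneg (d := c + s • d) hc hs hz) rfl
    exact ⟨c', h1, h2.trans hX, h3⟩

/-- X is injective, hence bounded below, on each coordinate subspace with independent columns. There
are finitely many, so the constants can be summed. -/
lemma exists_norm_le_of_independent (X : Matrix (Fin n) (Fin p) ℝ) :
    ∃ C : ℝ, ∀ c : Fin p → ℝ,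
      (∀ d : Fin p → ℝ, (∀ i, c i = 0 → d i = 0) → X *ᵥ d = 0 → d = 0) →
        ‖c‖ ≤ C * ‖X *ᵥ c‖ := by
  have key : ∀ A : Finset (Fin p), ∃ K : ℝ, 0 ≤ K ∧
      ((∀ d : Fin p → ℝ, (∀ i ∉ A, d i = 0) → X *ᵥ d = 0 → d = 0) →
        ∀ c : Fin p → ℝ, (∀ i ∉ A, c i = 0) → ‖c‖ ≤ K * ‖X *ᵥ c‖) := by
    intro A
    by_cases hA : ∀ d : Fin p → ℝ, (∀ i ∉ A, d i = 0) → X *ᵥ d = 0 → d = 0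
    swap
    · exact ⟨0, le_rfl, fun h => absurd h hA⟩
    let W : Submodule ℝ (Fin p → ℝ) :=
      { carrier := {d | ∀ i ∉ A, d i = 0}
        add_mem' := fun ha hb i hi => by simp [ha i hi, hb i hi]
        zero_mem' := fun _ _ => rfl
        smul_mem' := fun r a ha i hi => by simp [ha i hi] }
    obtain ⟨K, -, hK⟩ := LinearMap.exists_antilipschitzWith (X.mulVecLin.domRestrict W) (by
      refine LinearMap.ker_eq_bot'.2 fun d hd => Subtype.ext (hA d d.2 ?_)
      simpa using hd)
    refine ⟨K, K.2, fun _ c hc => ?_⟩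
    have h1 := hK.le_mul_dist (⟨c, hc⟩ : W) 0
    rw [map_zero, dist_zero_right, dist_zero_right] at h1
    exact h1
  choose K hK0 hK using key
  refine ⟨∑ A, K A, fun c hc => ?_⟩
  refine (hK (Finset.univ.filter fun i => c i ≠ 0) (fun d hd => hc d fun i hi => hd i (by simpa using hi))
    c fun i hi => by simpa using hi).trans ?_
  gcongr
  exact Finset.single_le_sum (f := K) (fun A _ => hK0 A) (Finset.mem_univ _)

lemma continuous_rss : Continuous (rss X y) := by
  unfold rss
  have : Continuous fun c : Fin p → ℝ => X *ᵥ c := continuous_const.matrix_mulVec continuous_id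
  fun_prop

lemma isClosed_signCone : IsClosed (signCone U L) := by
  have : signCone U L = ⋂ i, ({c | i ∉ U → c i ≤ 0} ∩ {c : Fin p → ℝ | i ∉ L → 0 ≤ c i}) := by
    ext c; simp [signCone]
  rw [this]
  refine isClosed_iInter fun i => IsClosed.inter ?_ ?_
  · by_cases h : i ∈ U
    · simp [h]
    · simpa [h] using isClosed_le (continuous_apply i) continuous_const
  · by_cases h : i ∈ L
    · simp [h]
    · simpa [h] using isClosed_le continuous_const (continuous_apply i)

lemma norm_le_sqrt_sum_sq (z : Fin n → ℝ) : ‖z‖ ≤ √(∑ k, z k ^ 2) := by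
  refine (pi_norm_le_iff_of_nonneg (Real.sqrt_nonneg _)).2 fun k => ?_
  rw [Real.norm_eq_abs]
  exact Real.abs_le_sqrt (Finset.single_le_sum (f := fun k => z k ^ 2)
    (fun _ _ => sq_nonneg _) (Finset.mem_univ k))

/-- Sign-constrained least squares has a solution. -/
lemma exists_isMinOn_rss (X : Matrix (Fin n) (Fin p) ℝ) (y : Fin n → ℝ)
    (U L : Finset (Fin p)) : ∃ m ∈ signCone U L, ∀ c ∈ signCone U L, rss X y m ≤ rss X y c := by
  obtain ⟨C, hC⟩ := exists_norm_le_of_independent X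
  -- X may have a kernel, so sublevel sets can be unbounded. A point no worse than 0 has ‖Xc‖ ≤
  -- 2√(rss 0), and its independent representative lies in the ball of radius R.
  set R := |C| * (2 * √(rss X y 0)) with hR
  have hR0 : 0 ≤ R := by positivity
  obtain ⟨m, hm, hmin⟩ := ((isCompact_closedBall (0 : Fin p → ℝ) R).inter_left
    (isClosed_signCone (U := U) (L := L))).exists_isMinOn
    ⟨0, zero_mem_signCone, Metric.mem_closedBall_self hR0⟩ continuous_rss.continuousOn
  refine ⟨m, hm.1, fun c hc => ?_⟩
  have hm0 : rss X y m ≤ rss X y 0 :=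
    hmin ⟨zero_mem_signCone, Metric.mem_closedBall_self hR0⟩
  rcases lt_or_ge (rss X y 0) (rss X y c) with h | h
  · exact hm0.trans h.le
  obtain ⟨c', hc', hX, hind⟩ := exists_independent_representative (X := X) hc
  have hrss : rss X y c' = rss X y c := by rw [rss, rss, hX]
  rw [← hrss]
  refine hmin ⟨hc', ?_⟩
  rw [mem_closedBall_zero_iff]
  refine (hC c' hind).trans ?_
  have h1 : ‖y‖ ≤ √(rss X y 0) := by
    simpa [rss] using norm_le_sqrt_sum_sq y
  have h2 : ‖y - X *ᵥ c'‖ ≤ √(rss X y 0) :=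
    (norm_le_sqrt_sum_sq _).trans (Real.sqrt_le_sqrt (hrss.le.trans h))
  have h3 : ‖X *ᵥ c'‖ ≤ 2 * √(rss X y 0) := by
    calc ‖X *ᵥ c'‖ = ‖y - (y - X *ᵥ c')‖ := by rw [sub_sub_cancel]
      _ ≤ ‖y‖ + ‖y - X *ᵥ c'‖ := norm_sub_le _ _
      _ ≤ _ := by linarith
  exact mul_le_mul (le_abs_self C) h3 (norm_nonneg _) (abs_nonneg C)

lemma residGrad_apply (c : Fin p → ℝ) (i : Fin p) :
    residGrad X y c i = (1 / (n : ℝ)) * ∑ k, (y - X *ᵥ c) k * X k i := by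
  simp only [residGrad, Pi.smul_apply, smul_eq_mul, mulVec, dotProduct, transpose_apply,
    mul_comm]

lemma rss_add_single (c : Fin p → ℝ) (i : Fin p) (s : ℝ) :
    rss X y (c + Pi.single i s)
      = rss X y c - 2 * s * (∑ k, (y - X *ᵥ c) k * X k i) + s ^ 2 * ∑ k, X k i ^ 2 := by
  rw [rss, rss, Finset.mul_sum, Finset.mul_sum, ← Finset.sum_sub_distrib, ← Finset.sum_add_distrib]
  refine Finset.sum_congr rfl fun k _ => ?_
  have : (X *ᵥ Pi.single i s) k = X k i * s := by
    simp [mulVec_single]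
  rw [mulVec_add, Pi.sub_apply, Pi.add_apply, this, Pi.sub_apply]
  ring

lemma nonpos_of_forall_quadratic_nonneg {a B δ : ℝ} (hδ : 0 < δ) (hB : 0 ≤ B)
    (h : ∀ s, 0 < s → s ≤ δ → 0 ≤ -2 * s * a + s ^ 2 * B) : a ≤ 0 := by
  by_contra! ha
  have hs : 0 < min δ (a / (B + 1)) := lt_min hδ (by positivity)
  have h1 := h _ hs (min_le_left _ _)
  set s := min δ (a / (B + 1))
  have h2 : s * (B + 1) ≤ a := by
    rw [← le_div_iff₀ (by positivity)]; exact min_le_right _ _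
  nlinarith [mul_pos hs ha, mul_pos hs hs]

variable {m : Fin p → ℝ}

lemma residGrad_nonpos (hmin : ∀ c ∈ signCone U L, rss X y m ≤ rss X y c) {i : Fin p} {δ : ℝ}
    (hδ : 0 < δ) (hf : ∀ s, 0 < s → s ≤ δ → m + Pi.single i s ∈ signCone U L) :
    residGrad X y m i ≤ 0 := by
  rw [residGrad_apply]
  refine mul_nonpos_of_nonneg_of_nonpos (by positivity)
    (nonpos_of_forall_quadratic_nonneg (B := ∑ k, X k i ^ 2) hδ
      (Finset.sum_nonneg fun k _ => sq_nonneg (X k i)) fun s hs hsδ => ?_)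
  have := hmin _ (hf s hs hsδ)
  rw [rss_add_single] at this
  linarith

lemma residGrad_nonneg (hmin : ∀ c ∈ signCone U L, rss X y m ≤ rss X y c) {i : Fin p} {δ : ℝ}
    (hδ : 0 < δ) (hf : ∀ s, 0 < s → s ≤ δ → m + Pi.single i (-s) ∈ signCone U L) :
    0 ≤ residGrad X y m i := by
  rw [residGrad_apply]
  refine mul_nonneg (by positivity) (neg_nonpos.1
    (nonpos_of_forall_quadratic_nonneg (B := ∑ k, X k i ^ 2) hδ
      (Finset.sum_nonneg fun k _ => sq_nonneg (X k i)) fun s hs hsδ => ?_))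
  have := hmin _ (hf s hs hsδ)
  rw [rss_add_single] at this
  linarith

lemma add_single_mem_signCone (hm : m ∈ signCone U L) {i : Fin p} {s : ℝ}
    (h : (i ∉ U → m i + s ≤ 0) ∧ (i ∉ L → 0 ≤ m i + s)) :
    m + Pi.single i s ∈ signCone U L := by
  intro j
  rcases eq_or_ne j i with rfl | hj
  · simpa using h
  · simpa [Pi.single_eq_of_ne hj] using hm j

/-- First order optimality conditions for sign-constrained least squares. -/
lemma residGrad_kkt (hm : m ∈ signCone U L)
    (hmin : ∀ c ∈ signCone U L, rss X y m ≤ rss X y c) (i : Fin p) :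
    (i ∈ U → residGrad X y m i ≤ 0) ∧ (i ∈ L → 0 ≤ residGrad X y m i) ∧
      (m i ≠ 0 → residGrad X y m i = 0) := by
  have hU : i ∈ U → residGrad X y m i ≤ 0 := fun hi =>
    residGrad_nonpos hmin one_pos fun s hs _ => add_single_mem_signCone hm
      ⟨fun h => absurd hi h, fun h => by linarith [(hm i).2 h]⟩
  have hL : i ∈ L → 0 ≤ residGrad X y m i := fun hi =>
    residGrad_nonneg hmin one_pos fun s hs _ => add_single_mem_signCone hm
      ⟨fun h => by linarith [(hm i).1 h], fun h => absurd hi h⟩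
  refine ⟨hU, hL, fun hi => ?_⟩
  rcases lt_or_gt_of_ne hi with hneg | hpos
  · have hiL : i ∈ L := by
      by_contra h; exact absurd ((hm i).2 h) (not_le.2 hneg)
    refine le_antisymm (residGrad_nonpos hmin (neg_pos.2 hneg) fun s hs hsδ =>
      add_single_mem_signCone hm ⟨fun _ => by linarith, fun h => absurd hiL h⟩) (hL hiL)
  · have hiU : i ∈ U := by
      by_contra h; exact absurd ((hm i).1 h) (not_le.2 hpos)
    exact le_antisymm (hU hiU) (residGrad_nonneg hmin hpos fun s hs hsδ =>
      add_single_mem_signCone hm ⟨fun h => absurd hiU h, fun _ => by linarith⟩)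

end Minimizer

/-! ### Construction of a path -/

/-- A solution of the Bregman inverse scale space dynamics with arbitrary initial dual variable. -/
structure IsPathFrom {n p : ℕ} (X : Matrix (Fin n) (Fin p) ℝ) (y : Fin n → ℝ)
    (r : Fin p → ℝ) (β ρ : ℝ → Fin p → ℝ) : Prop where
  rho_zero : ρ 0 = r
  rho_continuous : ContinuousOn ρ (Set.Ici 0)
  beta_rightContinuous : ∀ t : ℝ, 0 ≤ t → ContinuousWithinAt β (Set.Ici t) t
  rho_rightDeriv : ∀ t : ℝ, 0 ≤ t →
    HasDerivWithinAt ρ (residGrad X y (β t)) (Set.Ici t) t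
  rho_mem : ∀ t : ℝ, 0 ≤ t → ρ t ∈ subdiffL1 (β t)

section Construction

variable {n p : ℕ} {X : Matrix (Fin n) (Fin p) ℝ} {y : Fin n → ℝ}

lemma hasDerivWithinAt_add_smul (r g : Fin p → ℝ) (s : Set ℝ) (t : ℝ) :
    HasDerivWithinAt (fun t : ℝ => r + t • g) g s t := by
  simpa using (((hasDerivAt_id t).smul_const g).const_add r).hasDerivWithinAt

lemma isPathFrom_const {r m : Fin p → ℝ} (hr : r ∈ subdiffL1 m) (hg : residGrad X y m = 0) :
    IsPathFrom X y r (fun _ => m) fun _ => r where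
  rho_zero := rfl
  rho_continuous := continuousOn_const
  beta_rightContinuous _ _ := continuousWithinAt_const
  rho_rightDeriv t _ := by rw [hg]; exact hasDerivWithinAt_const _ _ _
  rho_mem _ _ := hr

/-- A linear piece followed by a path is a path. -/
lemma IsPathFrom.glue {r m : Fin p → ℝ} {t₁ : ℝ} (ht₁ : 0 < t₁) {β ρ : ℝ → Fin p → ℝ}
    (hmem : ∀ t ∈ Set.Icc 0 t₁, r + t • residGrad X y m ∈ subdiffL1 m)
    (h : IsPathFrom X y (r + t₁ • residGrad X y m) β ρ) :
    ∃ β' ρ' : ℝ → Fin p → ℝ, IsPathFrom X y r β' ρ' := by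
  set g := residGrad X y m with hg
  let β' : ℝ → Fin p → ℝ := fun t => if t < t₁ then m else β (t - t₁)
  -- Clamping the time in both summands makes continuity across t₁ immediate.
  let ρ' : ℝ → Fin p → ℝ := fun t =>
    (r + min t t₁ • g) + (ρ (max (t - t₁) 0) - (r + t₁ • g))
  have hρlt : ∀ t ≤ t₁, ρ' t = r + t • g := fun t ht => by
    simp only [ρ', min_eq_left ht, max_eq_right (sub_nonpos.2 ht), h.rho_zero, sub_self, add_zero]
  have hρge : ∀ t, t₁ ≤ t → ρ' t = ρ (t - t₁) := fun t ht => by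
    simp only [ρ', min_eq_right ht, max_eq_left (sub_nonneg.2 ht)]; abel
  have hβlt : ∀ t < t₁, β' t = m := fun t ht => if_pos ht
  have hβge : ∀ t, t₁ ≤ t → β' t = β (t - t₁) := fun t ht => if_neg (not_lt.2 ht)
  have hnear : ∀ t < t₁, ∀ᶠ s in nhdsWithin t (Set.Ici t), s < t₁ := fun t ht =>
    mem_nhdsWithin_of_mem_nhds (Iio_mem_nhds ht)
  have hfar : ∀ t, t₁ ≤ t → ∀ᶠ s in nhdsWithin t (Set.Ici t), t₁ ≤ s := fun t ht =>
    Filter.eventually_of_mem self_mem_nhdsWithin fun s hs => ht.trans hs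
  have hmaps : ∀ t : ℝ, Set.MapsTo (fun s => s - t₁) (Set.Ici t) (Set.Ici (t - t₁)) :=
    fun t s hs => sub_le_sub_right hs t₁
  refine ⟨β', ρ', ?_, ?_, fun t ht => ?_, fun t ht => ?_, fun t ht => ?_⟩
  · rw [hρlt 0 ht₁.le, zero_smul, add_zero]
  · refine ContinuousOn.add (by fun_prop) (ContinuousOn.sub ?_ continuousOn_const)
    exact h.rho_continuous.comp (by fun_prop) fun t _ => Set.mem_Ici.2 (le_max_right _ _)
  · rcases lt_or_ge t t₁ with hlt | hge
    · exact (continuousWithinAt_const (b := m)).congr_of_eventuallyEq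
        ((hnear t hlt).mono fun s hs => hβlt s hs) (hβlt t hlt)
    · exact ((h.beta_rightContinuous _ (sub_nonneg.2 hge)).comp (f := fun s => s - t₁)
        (by fun_prop) (hmaps t)).congr_of_eventuallyEq
        ((hfar t hge).mono fun s hs => hβge s hs) (hβge t hge)
  · rcases lt_or_ge t t₁ with hlt | hge
    · rw [hβlt t hlt]
      exact (hasDerivWithinAt_add_smul r g _ t).congr_of_eventuallyEq
        ((hnear t hlt).mono fun s hs => hρlt s (le_of_lt hs)) (hρlt t hlt.le)
    · rw [hβge t hge]
      have h1 := HasDerivWithinAt.scomp (h := fun s => s - t₁) t (h.rho_rightDeriv _ (sub_nonneg.2 hge))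
        ((hasDerivWithinAt_id t (Set.Ici t)).sub_const t₁) (hmaps t)
      rw [one_smul] at h1
      exact h1.congr_of_eventuallyEq ((hfar t hge).mono fun s hs => hρge s hs) (hρge t hge)
  · rcases lt_or_ge t t₁ with hlt | hge
    · rw [hβlt t hlt, hρlt t hlt.le]
      exact hmem t ⟨ht, hlt.le⟩
    · rw [hβge t hge, hρge t hge]
      exact h.rho_mem _ (sub_nonneg.2 hge)

/-- Coordinates at the upper bound. -/
noncomputable def upperSet (r : Fin p → ℝ) : Finset (Fin p) := Finset.univ.filter fun i => r i = 1

/-- Coordinates at the lower bound. -/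
noncomputable def lowerSet (r : Fin p → ℝ) : Finset (Fin p) :=
  Finset.univ.filter fun i => r i = -1

/-- Complementarity: a coordinate of m can be positive only where r is 1 and negative only where r
is -1. -/
lemma mem_signCone_iff_mem_subdiffL1 {r m : Fin p → ℝ} (hr : ∀ i, |r i| ≤ 1) :
    m ∈ signCone (upperSet r) (lowerSet r) ↔ r ∈ subdiffL1 m := by
  rw [mem_subdiffL1_iff]
  refine forall_congr' fun i => ?_
  simp only [hr i, true_and, upperSet, lowerSet, Finset.mem_filter, Finset.mem_univ]
  obtain ⟨h1, h2⟩ := abs_le.1 (hr i)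
  constructor
  · rintro ⟨hU, hL⟩
    rcases lt_trichotomy (m i) 0 with hm | hm | hm
    · have : r i = -1 := by
        by_contra h; exact absurd (hL h) (not_le.2 hm)
      rw [this, abs_of_neg hm, neg_one_mul]
    · simp [hm]
    · have : r i = 1 := by
        by_contra h; exact absurd (hU h) (not_le.2 hm)
      rw [this, abs_of_pos hm, one_mul]
  · intro h
    constructor
    · intro hU
      by_contra! hm
      rw [abs_of_pos hm] at h
      exact hU (mul_right_cancel₀ hm.ne' (h.trans (one_mul _).symm))
    · intro hL
      by_contra! hm
      rw [abs_of_neg hm] at h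
      exact hL (mul_right_cancel₀ hm.ne (h.trans (neg_one_mul _).symm))

/-- Following a nonzero admissible velocity, the cube is left after a positive time, and until then
the subgradient relation is preserved. -/
lemma exists_exit_time {r m g : Fin p → ℝ} (hr : r ∈ subdiffL1 m)
    (hU : ∀ i, r i = 1 → g i ≤ 0) (hL : ∀ i, r i = -1 → 0 ≤ g i)
    (hm : ∀ i, m i ≠ 0 → g i = 0) (hg : g ≠ 0) :
    ∃ t₁ : ℝ, 0 < t₁ ∧ (∀ t ∈ Set.Icc 0 t₁, r + t • g ∈ subdiffL1 m) ∧
      ∃ i, ((r + t₁ • g) i = 1 ∧ 0 < g i) ∨ ((r + t₁ • g) i = -1 ∧ g i < 0) := by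
  rw [mem_subdiffL1_iff] at hr
  obtain ⟨j, hj⟩ := Function.ne_iff.1 hg
  obtain ⟨i, hi, hmin⟩ := (Finset.univ.filter fun i => g i ≠ 0).exists_min_image
    (fun i => (1 / |g i| - r i / g i)) ⟨j, by simpa using hj⟩
  simp only [Finset.mem_filter, Finset.mem_univ, true_and] at hi hmin
  -- The time (sign g_i - r_i)/g_i at which coordinate i reaches the face it moves towards,
  -- minimised over moving coordinates.
  set t₁ := 1 / |g i| - r i / g i with ht₁
  have habs := fun k => abs_le.1 (hr k).1
  have hpos : 0 < t₁ := by
    rcases lt_or_gt_of_ne hi with h | h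
    · have h1 : r i ≠ -1 := fun h2 => absurd (hL i h2) (not_le.2 h)
      have h2 : -1 < r i := lt_of_le_of_ne (habs i).1 (Ne.symm h1)
      rw [ht₁, abs_of_neg h, show 1 / -g i - r i / g i = (1 + r i) / (-g i) by
        field_simp; ring]
      exact div_pos (by linarith) (by linarith)
    · have h1 : r i ≠ 1 := fun h2 => absurd (hU i h2) (not_le.2 h)
      have h2 : r i < 1 := lt_of_le_of_ne (habs i).2 h1
      rw [ht₁, abs_of_pos h, ← sub_div]
      exact div_pos (by linarith) h
  refine ⟨t₁, hpos, fun t ht => mem_subdiffL1_iff.2 fun k => ?_, i, ?_⟩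
  · simp only [Pi.add_apply, Pi.smul_apply, smul_eq_mul]
    by_cases hk : g k = 0
    · simpa [hk] using hr k
    · have hmk : m k = 0 := by
        by_contra h; exact hk (hm k h)
      refine ⟨?_, by simp [hmk]⟩
      have h1 : t ≤ 1 / |g k| - r k / g k := ht.2.trans (hmin k hk)
      rcases lt_or_gt_of_ne hk with h | h
      · have h2 : t * (-g k) ≤ 1 + r k := by
          rw [abs_of_neg h, show 1 / -g k - r k / g k = (1 + r k) / (-g k) by
            field_simp; ring, le_div_iff₀ (by linarith)] at h1
          exact h1
        refine abs_le.2 ⟨by linarith, ?_⟩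
        nlinarith [ht.1, (habs k).2]
      · have h2 : t * g k ≤ 1 - r k := by
          rw [abs_of_pos h, ← sub_div, le_div_iff₀ h] at h1
          exact h1
        refine abs_le.2 ⟨?_, by linarith⟩
        nlinarith [ht.1, (habs k).1]
  · simp only [Pi.add_apply, Pi.smul_apply, smul_eq_mul]
    rcases lt_or_gt_of_ne hi with h | h
    · right
      refine ⟨?_, h⟩
      rw [ht₁, abs_of_neg h]; field_simp; ring
    · left
      refine ⟨?_, h⟩
      rw [ht₁, abs_of_pos h]; field_simp; ring

/-- A path exists from every admissible dual variable: it is piecewise linear, and each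
breakpoint strictly decreases the residual among finitely many possible values. -/
lemma exists_isPathFrom (X : Matrix (Fin n) (Fin p) ℝ) (y : Fin n → ℝ) {r : Fin p → ℝ}
    (hr : ∀ i, |r i| ≤ 1) : ∃ β ρ : ℝ → Fin p → ℝ, IsPathFrom X y r β ρ := by
  classical
  choose M hM hMmin using fun Q : Finset (Fin p) × Finset (Fin p) =>
    exists_isMinOn_rss X y Q.1 Q.2
  induction hN : (Finset.univ.filter fun Q =>
      rss X y (M Q) < rss X y (M (upperSet r, lowerSet r))).card using Nat.strong_induction_on
    generalizing r with
  | _ N ih =>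
    set m := M (upperSet r, lowerSet r) with hm
    have hmem : m ∈ signCone (upperSet r) (lowerSet r) := hM (upperSet r, lowerSet r)
    have hkkt := residGrad_kkt hmem (hMmin (upperSet r, lowerSet r))
    have hrm := (mem_signCone_iff_mem_subdiffL1 hr).1 hmem
    by_cases hg : residGrad X y m = 0
    · exact ⟨_, _, isPathFrom_const hrm hg⟩
    obtain ⟨t₁, ht₁, hsub, i, hi⟩ := exists_exit_time hrm
      (fun i h => (hkkt i).1 (by simpa [upperSet] using h))
      (fun i h => (hkkt i).2.1 (by simpa [lowerSet] using h)) (fun i h => (hkkt i).2.2 h) hg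
    set r' := r + t₁ • residGrad X y m with hr'
    have hr'm := hsub t₁ ⟨ht₁.le, le_rfl⟩
    have hr'1 : ∀ i, |r' i| ≤ 1 := fun i => (mem_subdiffL1_iff.1 hr'm i).1
    have hm' := (mem_signCone_iff_mem_subdiffL1 hr'1).2 hr'm
    -- The old minimiser m is still admissible at r'. If it were still optimal, the optimality
    -- conditions would forbid the gradient from pointing outwards at the face just hit.
    have hlt : rss X y (M (upperSet r', lowerSet r')) < rss X y m := by
      refine lt_of_le_of_ne (hMmin (upperSet r', lowerSet r') m hm') fun heq => ?_
      have hkkt' := residGrad_kkt hm' (fun c hc => heq ▸ hMmin (upperSet r', lowerSet r') c hc) i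
      rcases hi with ⟨h1, h2⟩ | ⟨h1, h2⟩
      · exact absurd (hkkt'.1 (by simpa [upperSet] using h1)) (not_le.2 h2)
      · exact absurd (hkkt'.2.1 (by simpa [lowerSet] using h1)) (not_le.2 h2)
    obtain ⟨β, ρ, h⟩ := ih _ (by
      rw [← hN]
      refine Finset.card_lt_card (Finset.ssubset_iff_of_subset ?_ |>.2
        ⟨(upperSet r', lowerSet r'), by simpa using hlt, by simp⟩)
      intro Q hQ
      simp only [Finset.mem_filter, Finset.mem_univ, true_and] at hQ ⊢
      exact hQ.trans hlt) hr'1 rfl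
    exact h.glue ht₁ hsub

lemma exists_isPath (X : Matrix (Fin n) (Fin p) ℝ) (y : Fin n → ℝ) :
    ∃ β ρ : ℝ → Fin p → ℝ, IsPath X y β ρ := by
  obtain ⟨β, ρ, h⟩ := exists_isPathFrom X y (r := 0) (by simp)
  refine ⟨β, ρ, ?_, h.rho_zero, h.rho_continuous, h.beta_rightContinuous, h.rho_rightDeriv,
    h.rho_mem⟩
  -- β₀ = 0 is automatic: ρ₀ = 0 and |β_i| = ρ_i β_i.
  ext i
  have := (mem_subdiffL1_iff.1 (h.rho_mem 0 le_rfl) i).2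
  rw [h.rho_zero, Pi.zero_apply, zero_mul] at this
  exact abs_eq_zero.1 this.symm

end Construction

/-! ### Matching the noise levels, the threshold and the stopping time -/

section Thresholds

variable {n p : ℕ} {X : Matrix (Fin n) (Fin p) ℝ} {b : Fin p → ℝ} {σ γ η : ℝ}

lemma colNorm_le_maxColNormT (j : Cosupp b) : colNorm X j ≤ maxColNormT X b :=
  le_ciSup (f := fun j : Cosupp b => colNorm X j) (Set.finite_range _).bddAbove j

lemma maxColNormT_pos (hT : ∃ j, b j = 0 ∧ ∃ i, X i j ≠ 0) : 0 < maxColNormT X b := by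
  obtain ⟨j, hj, i, hi⟩ := hT
  refine lt_of_lt_of_le ?_ (colNorm_le_maxColNormT (X := X) ⟨j, hj⟩)
  have hn : (0 : ℝ) < n := by exact_mod_cast i.pos
  refine Real.sqrt_pos.2 (mul_pos (by positivity) ?_)
  exact lt_of_lt_of_le (pow_pos (abs_pos.2 hi) 2 |>.trans_eq (sq_abs _))
    (Finset.single_le_sum (f := fun i => X i j ^ 2) (fun _ _ => sq_nonneg _) (Finset.mem_univ i))

lemma tauBar_pos (hσ : 0 < σ) (hη : 0 < η) (hn : (0 : ℝ) < n) (hl : 0 < Real.log p)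
    (hM : 0 < maxColNormT X b) : 0 < tauBar X b σ η := by
  rw [tauBar]
  have : 0 < √((n : ℝ) / Real.log p) := Real.sqrt_pos.2 (div_pos hn hl)
  positivity

lemma mul_tauBar (hσ : 0 < σ) (hn : (0 : ℝ) < n) (hl : 0 < Real.log p)
    (hM : 0 < maxColNormT X b) :
    2 * σ * maxColNormT X b * √(Real.log p / n) * tauBar X b σ η = η := by
  rw [tauBar]
  have h1 : √(Real.log p / n) * √((n : ℝ) / Real.log p) = 1 := by
    rw [← Real.sqrt_mul (by positivity), div_mul_div_comm, mul_comm (n : ℝ),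
      div_self (by positivity), Real.sqrt_one]
  calc _ = (2 * σ) * (η / (2 * σ)) * (maxColNormT X b * (maxColNormT X b)⁻¹)
        * (√(Real.log p / n) * √((n : ℝ) / Real.log p)) := by ring
    _ = η := by rw [h1, mul_inv_cancel₀ hM.ne']; field_simp

/-- This is what the first entry of the maximum is for: the oracle keeps at least half of the
signal. -/
lemma noise_le_half_signalThreshold (hγ : 0 < γ) :
    2 * σ * √(Real.log p / (n * γ)) ≤ signalThreshold X b σ γ η / 2 := by
  have h1 : 4 * σ / √γ * √(Real.log p / n) ≤ signalThreshold X b σ γ η := by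
    rw [signalThreshold]; gcongr; exact le_max_left _ _
  rw [← div_div, Real.sqrt_div' _ hγ.le]
  have : 4 * σ / √γ * √(Real.log p / n) = 2 * (2 * σ * (√(Real.log p / n) / √γ)) := by ring
  linarith

/-- The second entry of the maximum is tuned so that, with m half the threshold, extinction occurs
no later than τ̄. -/
lemma le_tauBar_of_signalThreshold (hσ : 0 < σ) (hγ : 0 < γ) (hη : 0 < η) (hn : (0 : ℝ) < n)
    (hl : 0 < Real.log p) (hM : 0 < maxColNormT X b) (hpos : 0 < signalThreshold X b σ γ η) :
    2 * (2 + Real.log (Fintype.card (Supp b))) / (γ * (signalThreshold X b σ γ η / 2))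
      ≤ tauBar X b σ η := by
  have hτ := tauBar_pos hσ hη hn hl hM
  have h1 : 8 * σ * (2 + Real.log (Fintype.card (Supp b))) * maxColNormT X b / (γ * η)
      * √(Real.log p / n) ≤ signalThreshold X b σ γ η := by
    rw [signalThreshold]; gcongr; exact le_max_right _ _
  rw [div_le_iff₀ (by positivity)]
  calc 2 * (2 + Real.log (Fintype.card (Supp b)))
      = 2 * (2 + Real.log (Fintype.card (Supp b))) / η
        * (2 * σ * maxColNormT X b * √(Real.log p / n) * tauBar X b σ η) := by
        rw [mul_tauBar hσ hn hl hM]; field_simp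
    _ = tauBar X b σ η * (γ * ((8 * σ * (2 + Real.log (Fintype.card (Supp b)))
        * maxColNormT X b / (γ * η) * √(Real.log p / n)) / 2)) := by field_simp; ring
    _ ≤ _ := by gcongr

lemma sign_add_eq_of_abs_lt {u e : ℝ} (h : |e| < |u|) :
    SignType.sign (u + e) = SignType.sign u := by
  obtain ⟨h1, h2⟩ := abs_lt.1 h
  rcases lt_trichotomy u 0 with hu | hu | hu
  · rw [abs_of_neg hu] at h1 h2
    rw [sign_neg hu, sign_neg (by linarith)]
  · rw [hu, abs_zero] at h; exact absurd (abs_nonneg e) (not_le.2 h)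
  · rw [abs_of_pos hu] at h1 h2
    rw [sign_pos hu, sign_pos (by linarith)]

/-- The levels that the noise coefficients have to stay below. -/
noncomputable def noiseLevel (X : Matrix (Fin n) (Fin p) ℝ) (b : Fin p → ℝ) (σ γ : ℝ)
    (i : Fin p) : ℝ :=
  if b i ≠ 0 then 2 * σ * √(Real.log p / (n * γ))
  else 2 * σ * maxColNormT X b * √(Real.log p / n)

lemma noiseLevel_supp (i : Supp b) :
    noiseLevel X b σ γ i = 2 * σ * √(Real.log p / (n * γ)) := if_pos i.2

lemma noiseLevel_cosupp (j : Cosupp b) :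
    noiseLevel X b σ γ j = 2 * σ * maxColNormT X b * √(Real.log p / n) :=
  if_neg (not_not.2 j.2)

lemma noiseLevel_pos (hσ : 0 < σ) (hγ : 0 < γ) (hn : (0 : ℝ) < n) (hl : 0 < Real.log p)
    (hM : 0 < maxColNormT X b) (i : Fin p) : 0 < noiseLevel X b σ γ i := by
  have h1 : 0 < √(Real.log p / n) := Real.sqrt_pos.2 (by positivity)
  have h2 : 0 < √(Real.log p / (n * γ)) := Real.sqrt_pos.2 (by positivity)
  rw [noiseLevel]
  split_ifs <;> positivity

lemma noiseCoeff_le_noiseLevel (hσ : 0 < σ) (hγ : 0 < γ) (hl : 0 < Real.log p)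
    (hM : 0 < maxColNormT X b) (hA1 : RestrictedStrongConvexity X b γ) (i : Fin p) :
    σ * √(∑ k, noiseCoeff X b i k ^ 2) * (2 * √(Real.log p)) ≤ noiseLevel X b σ γ i := by
  by_cases hi : b i ≠ 0
  · have h1 := sum_sq_noiseCoeff_supp_le hγ hA1 ⟨i, hi⟩
    calc σ * √(∑ k, noiseCoeff X b i k ^ 2) * (2 * √(Real.log p))
        ≤ σ * √(1 / (n * γ)) * (2 * √(Real.log p)) := by gcongr
      _ = 2 * σ * (√(Real.log p) * √(1 / (n * γ))) := by ring
      _ = noiseLevel X b σ γ i := by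
        rw [← Real.sqrt_mul hl.le, mul_one_div, noiseLevel, if_pos hi]
  · have h1 := sum_sq_noiseCoeff_cosupp_le (gramS_isUnit_det hγ hA1) ⟨i, not_not.1 hi⟩
    have h2 : colNorm X i ^ 2 / n ≤ maxColNormT X b ^ 2 * (1 / n) := by
      rw [mul_one_div]
      gcongr
      · exact Real.sqrt_nonneg _
      · exact colNorm_le_maxColNormT ⟨i, not_not.1 hi⟩
    calc σ * √(∑ k, noiseCoeff X b i k ^ 2) * (2 * √(Real.log p))
        ≤ σ * √(maxColNormT X b ^ 2 * (1 / n)) * (2 * √(Real.log p)) := by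
          gcongr; exact h1.trans h2
      _ = 2 * σ * maxColNormT X b * (√(Real.log p) * √(1 / n)) := by
        rw [Real.sqrt_mul (sq_nonneg _), Real.sqrt_sq hM.le]; ring
      _ = noiseLevel X b σ γ i := by
        rw [← Real.sqrt_mul hl.le, mul_one_div, noiseLevel, if_neg hi]

end Thresholds

/-! ### Conclusions on the noise event -/

section Deterministic

variable {n p : ℕ} {X : Matrix (Fin n) (Fin p) ℝ} {b : Fin p → ℝ} {σ γ η : ℝ} {e : Fin n → ℝ}
  {β ρ : ℝ → Fin p → ℝ}

lemma IsPath.abs_rho_lt_one_of_le_tauBar (h : IsPath X (X *ᵥ b + e) β ρ)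
    (hσ : 0 < σ) (hγ : 0 < γ) (hη : 0 < η) (hn : (0 : ℝ) < n) (hl : 0 < Real.log p)
    (hM : 0 < maxColNormT X b) (hA1 : RestrictedStrongConvexity X b γ)
    (hA2 : Irrepresentable X b η)
    (he : ∀ i, |∑ k, noiseCoeff X b i k * e k| < noiseLevel X b σ γ i)
    {t : ℝ} (ht0 : 0 ≤ t) (ht : t ≤ tauBar X b σ η) (j : Cosupp b) : |ρ t j| < 1 := by
  refine h.abs_rho_lt_one (fun c hc j => residGrad_cosupp (gramS_isUnit_det hγ hA1) e hc j) hA2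
    (fun j => ?_) ht0 ht j
  rw [← sum_noiseCoeff_cosupp]
  have h1 := he j
  rw [noiseLevel_cosupp] at h1
  calc _ < 2 * σ * maxColNormT X b * √(Real.log p / n) * tauBar X b σ η :=
        mul_lt_mul_of_pos_right h1 (tauBar_pos hσ hη hn hl hM)
    _ = η := mul_tauBar hσ hn hl hM

lemma IsPath.beta_tauBar_eq_oracle (h : IsPath X (X *ᵥ b + e) β ρ)
    (hσ : 0 < σ) (hγ : 0 < γ) (hη : 0 < η) (hn : (0 : ℝ) < n) (hl : 0 < Real.log p)
    (hM : 0 < maxColNormT X b) (hA1 : RestrictedStrongConvexity X b γ)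
    (hA2 : Irrepresentable X b η)
    (he : ∀ i, |∑ k, noiseCoeff X b i k * e k| < noiseLevel X b σ γ i)
    (hsig : ∀ i, b i ≠ 0 → signalThreshold X b σ γ η ≤ |b i|) :
    β (tauBar X b σ η) = oracle X b (X *ᵥ b + e) := by
  have hτ := tauBar_pos hσ hη hn hl hM
  have hnoise := noise_le_half_signalThreshold (X := X) (b := b) (σ := σ) (η := η) hγ
  have hpos : 0 < signalThreshold X b σ γ η := by
    have : 0 < √(Real.log p / (n * γ)) := Real.sqrt_pos.2 (by positivity)
    have : 0 < 2 * σ * √(Real.log p / (n * γ)) := by positivity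
    linarith
  refine h.beta_eq_of_le (b := b) hγ (half_pos hpos) hτ.le
    (fun t ht j => h.beta_eq_zero ht.1
      (h.abs_rho_lt_one_of_le_tauBar hσ hγ hη hn hl hM hA1 hA2 he ht.1 ht.2 j))
    (oracle_apply_cosupp _) (fun i => ?_)
    (fun c hc => mul_sum_sq_le_sum_residGrad_mul hγ hA1 _ hc)
    (le_tauBar_of_signalThreshold hσ hγ hη hn hl hM hpos)
  rw [oracle_apply_supp_eq (gramS_isUnit_det hγ hA1)]
  have h1 := he i
  rw [noiseLevel_supp] at h1
  have h2 := abs_sub_abs_le_abs_add (b i) (∑ k, noiseCoeff X b i k * e k)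
  linarith [hsig i i.2]

lemma sign_oracle_eq (hγ : 0 < γ) (hA1 : RestrictedStrongConvexity X b γ)
    (he : ∀ i, |∑ k, noiseCoeff X b i k * e k| < noiseLevel X b σ γ i)
    (hsig : ∀ i, b i ≠ 0 → signalThreshold X b σ γ η ≤ |b i|) (i : Fin p) :
    SignType.sign (oracle X b (X *ᵥ b + e) i) = SignType.sign (b i) := by
  by_cases hi : b i = 0
  · rw [oracle_apply_cosupp _ ⟨i, hi⟩, hi]
  · have h1 := oracle_apply_supp_eq (gramS_isUnit_det hγ hA1) e ⟨i, hi⟩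
    rw [h1]
    refine sign_add_eq_of_abs_lt ?_
    have h2 := he i
    rw [noiseLevel_supp ⟨i, hi⟩] at h2
    have h3 := noise_le_half_signalThreshold (X := X) (b := b) (n := n) (p := p) (σ := σ)
      (η := η) hγ
    have h4 := hsig i hi
    have h5 := abs_nonneg (∑ k, noiseCoeff X b i k * e k)
    change |∑ k, noiseCoeff X b i k * e k| < |b i|
    linarith

end Deterministic

end BregmanISS

theorem mainTheorem1 {Ω : Type*} [MeasurableSpace Ω] (P : Measure Ω) [IsProbabilityMeasure P]
    (n p : ℕ) (hp : 2 ≤ p)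
    (X : Matrix (Fin n) (Fin p) ℝ) (βstar : Fin p → ℝ)
    (hT : ∃ j, βstar j = 0 ∧ ∃ i, X i j ≠ 0)
    (σ : ℝ) (hσ : 0 < σ)
    (ε : Ω → Fin n → ℝ)
    (hε : HasLaw ε (Measure.pi fun _ : Fin n => gaussianReal 0 (Real.toNNReal (σ ^ 2))) P)
    (γ : ℝ) (hγ : 0 < γ) (hγ1 : γ ≤ 1) (hA1 : BregmanISS.RestrictedStrongConvexity X βstar γ)
    (η : ℝ) (hη : 0 < η) (hη1 : η < 1) (hA2 : BregmanISS.Irrepresentable X βstar η) :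
    (∃ E : Set Ω, MeasurableSet E ∧
      1 - 2 / ((p : ℝ) * √(Real.pi * Real.log p)) ≤ P.real E ∧
      ∀ ω ∈ E,
        (∃ β ρ : ℝ → Fin p → ℝ, BregmanISS.IsPath X (X.mulVec βstar + ε ω) β ρ) ∧
        ∀ β ρ : ℝ → Fin p → ℝ, BregmanISS.IsPath X (X.mulVec βstar + ε ω) β ρ →
          (∀ t : ℝ, 0 ≤ t → t ≤ BregmanISS.tauBar X βstar σ η →
            Function.support (β t) ⊆ Function.support βstar) ∧
          ((∀ i, βstar i ≠ 0 → BregmanISS.signalThreshold X βstar σ γ η ≤ |βstar i|) →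
            (∀ i, SignType.sign (β (BregmanISS.tauBar X βstar σ η) i)
              = SignType.sign (βstar i)) ∧
            β (BregmanISS.tauBar X βstar σ η)
              = BregmanISS.oracle X βstar (X.mulVec βstar + ε ω))) ∧
    (∀ i, Integrable (fun ω => BregmanISS.oracle X βstar (X.mulVec βstar + ε ω) i) P ∧
      ∫ ω, BregmanISS.oracle X βstar (X.mulVec βstar + ε ω) i ∂P = βstar i) := by
  -- A nonzero column needs a row index, so n > 0.
  obtain ⟨i₀, -⟩ := hT.choose_spec.2
  have hn : (0 : ℝ) < n := by exact_mod_cast i₀.pos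
  have hl : 0 < Real.log p := Real.log_pos (by exact_mod_cast hp)
  have hM := BregmanISS.maxColNormT_pos hT
  have hG := BregmanISS.gramS_isUnit_det hγ hA1
  constructor
  · obtain ⟨E, hE, hPE, hEω⟩ := BregmanISS.exists_event_abs_noise_sum_lt hp hσ hε
      (BregmanISS.noiseCoeff X βstar) (BregmanISS.noiseLevel X βstar σ γ)
      (BregmanISS.noiseLevel_pos hσ hγ hn hl hM)
      (BregmanISS.noiseCoeff_le_noiseLevel hσ hγ hl hM hA1)
    refine ⟨E, hE, hPE, fun ω hω => ⟨BregmanISS.exists_isPath _ _, fun β ρ h => ⟨?_, ?_⟩⟩⟩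
    · intro t ht0 ht i hi hb
      exact hi (h.beta_eq_zero ht0 (h.abs_rho_lt_one_of_le_tauBar hσ hγ hη hn hl hM hA1 hA2
        (hEω ω hω) ht0 ht ⟨i, hb⟩))
    · intro hsig
      have heq := h.beta_tauBar_eq_oracle hσ hγ hη hn hl hM hA1 hA2 (hEω ω hω) hsig
      exact ⟨fun i => heq ▸ BregmanISS.sign_oracle_eq hγ hA1 (hEω ω hω) hsig i, heq⟩
  · intro i
    by_cases hi : βstar i = 0
    · have h0 : ∀ ω, BregmanISS.oracle X βstar (X.mulVec βstar + ε ω) i = 0 := fun ω =>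
        BregmanISS.oracle_apply_cosupp _ ⟨i, hi⟩
      simp [h0, hi]
    · have h1 : ∀ ω, BregmanISS.oracle X βstar (X.mulVec βstar + ε ω) i
          = βstar i + ∑ k, BregmanISS.noiseCoeff X βstar i k * ε ω k := fun ω =>
        BregmanISS.oracle_apply_supp_eq hG (ε ω) ⟨i, hi⟩
      have hint := BregmanISS.integrable_noise_sum hε (BregmanISS.noiseCoeff X βstar i)
      simp_rw [h1]
      refine ⟨(integrable_const _).add hint, ?_⟩
      rw [integral_add (integrable_const _) hint, BregmanISS.integral_noise_sum hε]
      simp
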